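/- Let $s\in\mathbb N$, $[s]=\{1,\dots,s\}$, let $-\infty<a_i<b_i<\infty$ for $i\in[s]$ and $[\boldsymbol a,\boldsymbol b]=\prod_{i=1}^s[a_i,b_i]$. For $i\in[s]$ let $\varphi_i:[a_i,b_i]\to[0,\infty)$ be a probability density with respect to Lebesgue measure whose distribution function $\Phi_i(x)=\int_{a_i}^x\varphi_i(y)\,\mathrm dy$ is a bijection $[a_i,b_i]\to[0,1]$; put $\varphi(\boldsymbol x)=\prod_{i=1}^s\varphi_i(x_i)$ and $\Phi^{-1}(\boldsymbol y)=(\Phi_1^{-1}(y_1),\dots,\Phi_s^{-1}(y_s))$ for $\boldsymbol y\in[0,1]^s$. Let $\gamma_{\mathfrak u}>0$ for $\mathfrak u\subseteq[s]$. For $F:[\boldsymbol a,\boldsymbol b]\to\mathbb R$ whose mixed partial derivatives $\frac{\partial^{|\mathfrak u|}F}{\partial\boldsymbol x_{\mathfrak u}}=\frac{\partial^kF}{\partial x_{u_1}\cdots\partial x_{u_k}}$, $\mathfrak u=\{u_1<\dots<u_k\}\subseteq[s]$, exist everywhere on $[\boldsymbol a,\boldsymbol b]$ (one-sided on the faces),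 let $$\|F\|_{\infty,s,\boldsymbol\gamma}=\max_{\mathfrak u\subseteq[s]}\frac1{\gamma_{\mathfrak u}}\sup_{\boldsymbol x\in[\boldsymbol a,\boldsymbol b]}\left|\frac{\partial^{|\mathfrak u|}F}{\partial\boldsymbol x_{\mathfrak u}}(\boldsymbol x)\right|.$$ The worst-case error of nodes $\mathcal P=(\boldsymbol y_0,\dots,\boldsymbol y_{N-1})$ in $[0,1)^s$ (counted with multiplicity) is $$\mathrm{wce}(\mathcal P;\infty,s,\boldsymbol\gamma,\varphi)=\sup_{\|F\|_{\infty,s,\boldsymbol\gamma}\le1}\left|\frac1N\sum_{n=0}^{N-1}F(\Phi^{-1}(\boldsymbol y_n))-\int_{[\boldsymbol a,\boldsymbol b]}F(\boldsymbol x)\varphi(\boldsymbol x)\,\mathrm d\boldsymbol x\right|.$$ For $m\in\mathbb N$ let $G_m=\{h\in\mathbb F_2[x]:\deg(h)<m\}$ (which contains $0$), and for a Laurent series $L=\sum_{k\ge w}c_kx^{-k}\in\mathbb F_2((x^{-1}))$ let $\{L\}_m=\sum_{k=\max(1,w)}^mc_k2^{-k}$. For $f\in\mathbb F_2[x]$ with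 $\deg(f)=m$ and $\boldsymbol g=(g_1,\dots,g_s)\in\mathbb F_2[x]^s$ the polynomial lattice point set $\mathcal P(\boldsymbol g,f)$ consists of the $2^m$ points $\left(\{hg_1/f\}_m,\dots,\{hg_s/f\}_m\right)$, $h\in G_m$. **Claim.** For every irreducible $f\in\mathbb F_2[x]$ with $\deg(f)=m$ there exists $\boldsymbol g^*\in G_m^s$ such that $$\mathrm{wce}(\mathcal P(\boldsymbol g^*,f);\infty,s,\boldsymbol\gamma,\varphi)\le\frac1{2^m}\sum_{\emptyset\ne\mathfrak u\subseteq[s]}\gamma_{\mathfrak u}\left(2^{|\mathfrak u|}+\left(\frac m2\right)^{|\mathfrak u|}\right)\prod_{i\in\mathfrak u}(b_i-a_i).$$ -/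

import Mathlib

open scoped ENNReal Polynomial BigOperators

namespace PolyLatticeQMC

noncomputable section

/-! ### Product densities and the componentwise inverse distribution function -/

/-- `ψ` is a probability density function on `[a, b]` with respect to Lebesgue measure.
(The integral being `1` forces `ψ` to be integrable on `[a, b]`.) -/
def IsPDFOn (ψ : ℝ → ℝ) (a b : ℝ) : Prop :=
  (∀ x ∈ Set.Icc a b, 0 ≤ ψ x) ∧ ∫ x in a..b, ψ x = 1

/-- The cumulative distribution function `x ↦ ∫ y in a..x, ψ y`. -/
def cdfFrom (ψ : ℝ → ℝ) (a : ℝ) (x : ℝ) : ℝ :=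
  ∫ y in a..x, ψ y

/-- The componentwise inverse `Φ⁻¹(y) = (Φ₁⁻¹(y₁), …, Φₛ⁻¹(yₛ))`, where `Φᵢ⁻¹` is the inverse of
`Φᵢ : [aᵢ, bᵢ] → [0, 1]`. -/
def invCDF {s : ℕ} (a b : Fin s → ℝ) (φ : Fin s → ℝ → ℝ) (y : Fin s → ℝ) : Fin s → ℝ :=
  fun i => Function.invFunOn (cdfFrom (φ i) (a i)) (Set.Icc (a i) (b i)) (y i)

/-! ### Mixed partial derivatives on the cube and the weighted norm -/

/-- The partial derivative of `F` in the `i`-th variable on the cube `[a, b]`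
(one-sided on the faces of the cube). -/
def partialD {s : ℕ} (a b : Fin s → ℝ) (i : Fin s) (F : (Fin s → ℝ) → ℝ) : (Fin s → ℝ) → ℝ :=
  fun x => derivWithin (fun t => F (Function.update x i t)) (Set.Icc (a i) (b i)) (x i)

/-- `∂^|u| F / ∂x_u = ∂^k F / (∂x_{u₁} ∂x_{u₂} ⋯ ∂x_{u_k})` for `u = {u₁ < u₂ < ⋯ < u_k}`. -/
def mixedPartial {s : ℕ} (a b : Fin s → ℝ) (u : Finset (Fin s)) (F : (Fin s → ℝ) → ℝ) :
    (Fin s → ℝ) → ℝ :=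
  (u.sort (· ≤ ·)).foldr (partialD a b) F

/-- All mixed partial derivatives `∂^|u| F / ∂x_u`, `u ⊆ [s]`, exist everywhere on `[a, b]`:
whenever `i` lies below all elements of `u`, the derivative `∂^|u| F / ∂x_u` can be differentiated
once more, in the `i`-th variable. -/
def HasMixedPartials {s : ℕ} (a b : Fin s → ℝ) (F : (Fin s → ℝ) → ℝ) : Prop :=
  ∀ (u : Finset (Fin s)) (i : Fin s), (∀ j ∈ u, i < j) → ∀ x ∈ Set.Icc a b,
    DifferentiableWithinAt ℝ (fun t => mixedPartial a b u F (Function.update x i t))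
      (Set.Icc (a i) (b i)) (x i)

/-- The term `(1 / γ_u) sup_{x ∈ [a, b]} |∂^|u| F / ∂x_u (x)|` (possibly infinite). -/
def normTerm {s : ℕ} (a b : Fin s → ℝ) (γ : Finset (Fin s) → ℝ) (F : (Fin s → ℝ) → ℝ)
    (u : Finset (Fin s)) : ℝ≥0∞ :=
  ENNReal.ofReal (1 / γ u) * ⨆ x ∈ Set.Icc a b, ENNReal.ofReal |mixedPartial a b u F x|

/-- The weighted norm `‖F‖_{p,s,γ}` (possibly infinite): the `ℓ^p` norm of the family of
`normTerm`s over all `u ⊆ [s]`, including `u = ∅`. -/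
def weightedNorm {s : ℕ} (p : ℝ≥0∞) (a b : Fin s → ℝ) (γ : Finset (Fin s) → ℝ)
    (F : (Fin s → ℝ) → ℝ) : ℝ≥0∞ :=
  if p = ∞ then ⨆ u : Finset (Fin s), normTerm a b γ F u
  else (∑ u : Finset (Fin s), normTerm a b γ F u ^ p.toReal) ^ (1 / p.toReal)

/-! ### Integration error and worst-case error -/

/-- The error of the QMC rule with (finite, indexed) nodes `y`:
`(1/N) ∑ₙ F(Φ⁻¹(yₙ)) - ∫_{[a,b]} F(x) φ(x) dx` with `φ(x) = ∏ᵢ φᵢ(xᵢ)`. -/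
def qmcError {s : ℕ} {ι : Type} [Fintype ι] (a b : Fin s → ℝ) (φ : Fin s → ℝ → ℝ)
    (y : ι → Fin s → ℝ) (F : (Fin s → ℝ) → ℝ) : ℝ :=
  1 / (Fintype.card ι : ℝ) * ∑ n, F (invCDF a b φ (y n))
    - ∫ x in Set.Icc a b, F x * ∏ i, φ i (x i)

/-- The worst-case error: the supremum of `|err(F)|` over all `F` with `‖F‖_{p,s,γ} ≤ 1`. -/
def worstCaseError {s : ℕ} {ι : Type} [Fintype ι] (p : ℝ≥0∞) (a b : Fin s → ℝ)
    (γ : Finset (Fin s) → ℝ) (φ : Fin s → ℝ → ℝ) (y : ι → Fin s → ℝ) : ℝ≥0∞ :=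
  ⨆ (F : (Fin s → ℝ) → ℝ) (_ : HasMixedPartials a b F) (_ : weightedNorm p a b γ F ≤ 1),
    ENNReal.ofReal |qmcError a b φ y F|

/-! ### Polynomial lattice point sets over `𝔽₂` -/

/-- `G_m`, the set of polynomials over `𝔽₂` of degree less than `m`. -/
abbrev G (m : ℕ) : Submodule (ZMod 2) (ZMod 2)[X] :=
  Polynomial.degreeLT (ZMod 2) m

instance (m : ℕ) : Fintype (G m) :=
  Fintype.ofEquiv (Fin m → ZMod 2) (Polynomial.degreeLTEquiv (ZMod 2) m).symm.toEquiv

/-- The embedding `𝔽₂[x] → 𝔽₂((x⁻¹))`. The field `𝔽₂((x⁻¹))` is realised as the field of Laurent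
series in a variable `T` that stands for `x⁻¹`, so `x` is sent to `T⁻¹`, and the coefficient of
`x⁻ᵏ` is the coefficient with index `k`. -/
def toLaurent : (ZMod 2)[X] →ₐ[ZMod 2] LaurentSeries (ZMod 2) :=
  Polynomial.aeval (HahnSeries.single (-1 : ℤ) (1 : ZMod 2))

/-- `{L}_m = ∑_{k=1}^m a_k 2⁻ᵏ` for `L = ∑_k a_k x⁻ᵏ ∈ 𝔽₂((x⁻¹))`. -/
def fracPart (m : ℕ) (L : LaurentSeries (ZMod 2)) : ℝ :=
  ∑ k ∈ Finset.Icc 1 m, ((L.coeff (k : ℤ)).val : ℝ) / 2 ^ k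

/-- The polynomial lattice point set `P(g, f)`, with `m = deg f`: the points
`x_h = ({h g₁ / f}_m, …, {h gₛ / f}_m)`, indexed by the polynomials `h` with `deg h < m`
(so that points are counted with multiplicity). -/
def polyLattice {s : ℕ} (g : Fin s → (ZMod 2)[X]) (f : (ZMod 2)[X]) :
    G f.natDegree → Fin s → ℝ :=
  fun h i => fracPart f.natDegree
    (toLaurent ((h : (ZMod 2)[X]) * g i) / toLaurent f)

end

end PolyLatticeQMC

namespace PolyLatticeQMC

noncomputable section

/-! In one variable, g(ξ) = ∫ g dμ + ∫ g'(t) (Φ(t) - 1_{ξ<t}) dt, where Φ is the distribution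
function of μ. Applied in every coordinate (`IsDerivFamily.eq_sum_integral_piecewise`), this writes
F(ξ) as a sum over u ⊆ [s] whose u = ∅ term is exactly ∫ F φ. Averaging over the nodes bounds the
error by the derivatives of F times the sums Σ_h ∏_{i∈u} (z_i - 1_{y_{h,i}<z_i}) at z_i = Φ_i(t_i)
(`IsDerivFamily.abs_error_le`).

Rounding each z_i up to a multiple of 2⁻ᵐ leaves the indicators unchanged and costs at most |u| over
all 2ᵐ points. On this grid each factor has a Walsh expansion with coefficients bounded by `rho`,
and `rho` vanishes at index 0. Character sums over the group G_m are nonnegative, so each factor may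
be replaced by `walMajorant`, whose Walsh coefficients are `rho` (`abs_sum_prod_walsh_le`).

These majorants are then averaged over all generating vectors (`sum_sum_prod_walMajorant`). The term
h = 0 gives (m/2)^|u|. For h ≠ 0, irreducibility of f makes g_i ↦ digits of h g_i / f a bijection
onto 𝔽₂ᵐ, where `walMajorant` sums to 0. Some vector is at most the average, and |u| ≤ 2^|u| gives
the stated bound. -/

/-! ### Walsh functions on `𝔽₂ᵐ` -/

/-- The nontrivial real character of `ZMod 2`. -/
def zsign (x : ZMod 2) : ℝ := if x = 0 then 1 else -1

@[simp] lemma zsign_zero : zsign 0 = 1 := by simp [zsign]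

@[simp] lemma zsign_one : zsign 1 = -1 := by simp [zsign]

lemma eq_zero_or_eq_one (x : ZMod 2) : x = 0 ∨ x = 1 := by revert x; decide

lemma zsign_add (x y : ZMod 2) : zsign (x + y) = zsign x * zsign y := by
  have h : (1 + 1 : ZMod 2) = 0 := by decide
  rcases eq_zero_or_eq_one x with rfl | rfl <;> rcases eq_zero_or_eq_one y with rfl | rfl <;>
    simp [h]

/-- The Walsh function with index `k`, in terms of the digit vector `y`. -/
def wal {m : ℕ} (k y : Fin m → ZMod 2) : ℝ := ∏ j, zsign (k j * y j)

@[simp] lemma wal_zero_right {m : ℕ} (k : Fin m → ZMod 2) : wal k 0 = 1 := by simp [wal]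

@[simp] lemma wal_zero_left {m : ℕ} (y : Fin m → ZMod 2) : wal 0 y = 1 := by simp [wal]

lemma wal_add {m : ℕ} (k x y : Fin m → ZMod 2) : wal k (x + y) = wal k x * wal k y := by
  simp [wal, mul_add, zsign_add, Finset.prod_mul_distrib]

lemma wal_cons {m : ℕ} (k₀ y₀ : ZMod 2) (k y : Fin m → ZMod 2) :
    wal (Fin.cons k₀ k : Fin (m + 1) → ZMod 2) (Fin.cons y₀ y) = zsign (k₀ * y₀) * wal k y := by
  simp [wal, Fin.prod_univ_succ]

/-- A sum over `𝔽₂ᵐ⁺¹`, split according to the first digit. -/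
lemma sum_digits_succ {m : ℕ} (F : (Fin (m + 1) → ZMod 2) → ℝ) :
    ∑ k, F k = ∑ k : Fin m → ZMod 2, (F (Fin.cons 0 k) + F (Fin.cons 1 k)) := by
  rw [← (Fin.consEquiv (fun _ : Fin (m + 1) => ZMod 2)).sum_comp, Fintype.sum_prod_type_right]
  refine Finset.sum_congr rfl fun k _ => ?_
  exact Fin.sum_univ_two (fun x : ZMod 2 => F (Fin.cons x k))

lemma sum_wal_right {m : ℕ} (k : Fin m → ZMod 2) :
    ∑ y, wal k y = if k = 0 then 2 ^ m else 0 := by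
  induction m with
  | zero => simp [Subsingleton.elim k 0, wal]
  | succ m ih =>
    obtain ⟨k₀, k, rfl⟩ : ∃ k₀ k', k = Fin.cons k₀ k' := ⟨k 0, Fin.tail k, by simp⟩
    rw [sum_digits_succ]
    simp only [wal_cons, mul_zero, zsign_zero, one_mul, mul_one]
    rw [Finset.sum_add_distrib, ← Finset.mul_sum, ih]
    have h0 : (Fin.cons k₀ k : Fin (m + 1) → ZMod 2) = 0 ↔ k₀ = 0 ∧ k = 0 := by
      constructor
      · intro h
        exact ⟨by simpa using congrFun h 0, by ext j; simpa using congrFun h j.succ⟩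
      · rintro ⟨rfl, rfl⟩
        ext j; refine Fin.cases ?_ (fun j => ?_) j <;> simp
    rw [if_congr h0 rfl rfl]
    rcases eq_zero_or_eq_one k₀ with rfl | rfl
    · by_cases hk : k = 0 <;> simp [hk, pow_succ]; ring
    · by_cases hk : k = 0 <;> simp [hk]

/-- The bound for the Walsh coefficients of indicators of intervals `[0, z)`: it is `2⁻ʳ` when
the last nonzero digit of `k` is the `r`-th one. -/
def rho : (m : ℕ) → (Fin m → ZMod 2) → ℝ
  | 0, _ => 0
  | m + 1, k => rho m (Fin.tail k) / 2 + if k = Fin.cons 1 0 then 1 / 2 else 0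

lemma rho_cons_zero {m : ℕ} (k : Fin m → ZMod 2) :
    rho (m + 1) (Fin.cons 0 k) = rho m k / 2 := by
  simp [rho]

lemma rho_cons_one {m : ℕ} (k : Fin m → ZMod 2) :
    rho (m + 1) (Fin.cons 1 k) = rho m k / 2 + if k = 0 then 1 / 2 else 0 := by
  simp [rho]

lemma rho_zero (m : ℕ) : rho m 0 = 0 := by
  induction m with
  | zero => rfl
  | succ m ih =>
    have : (0 : Fin (m + 1) → ZMod 2) = Fin.cons 0 0 := by
      ext j; refine Fin.cases ?_ (fun j => ?_) j <;> simp
    rw [this, rho_cons_zero, ih, zero_div]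

/-- There are 2^(r-1) indices whose last nonzero digit is the r-th, each of weight 2⁻ʳ, so every r ≤
m contributes 1/2. -/
lemma sum_rho (m : ℕ) : ∑ k, rho m k = m / 2 := by
  induction m with
  | zero => simp [rho]
  | succ m ih =>
    rw [sum_digits_succ]
    simp only [rho_cons_zero, rho_cons_one]
    simp only [Finset.sum_add_distrib, ← Finset.sum_div, ih]
    simp
    ring

/-- The number in `[0, 1)` with binary digits `y`. -/
def bval {m : ℕ} (y : Fin m → ZMod 2) : ℝ := ∑ j, ((y j).val : ℝ) / 2 ^ ((j : ℕ) + 1)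

lemma bval_cons {m : ℕ} (y₀ : ZMod 2) (y : Fin m → ZMod 2) :
    bval (Fin.cons y₀ y : Fin (m + 1) → ZMod 2) = (y₀.val + bval y) / 2 := by
  simp only [bval, Fin.sum_univ_succ, Fin.cons_zero, Fin.cons_succ, Fin.val_zero, Fin.val_succ]
  rw [add_div, Finset.sum_div]
  congr 1
  · simp
  · exact Finset.sum_congr rfl fun j _ => by rw [pow_succ (2 : ℝ) (j + 1)]; field_simp

lemma bval_nonneg {m : ℕ} (y : Fin m → ZMod 2) : 0 ≤ bval y :=
  Finset.sum_nonneg fun _ _ => by positivity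

lemma bval_lt_one {m : ℕ} (y : Fin m → ZMod 2) : bval y < 1 := by
  induction m with
  | zero => simp [bval]
  | succ m ih =>
    obtain ⟨y₀, y, rfl⟩ : ∃ y₀ y', y = Fin.cons y₀ y' := ⟨y 0, Fin.tail y, by simp⟩
    rw [bval_cons]
    have h := ih y
    have h0 : (y₀.val : ℝ) ≤ 1 := by
      exact_mod_cast Nat.lt_succ_iff.mp (ZMod.val_lt y₀)
    linarith

lemma exists_bval_eq {m : ℕ} (y : Fin m → ZMod 2) : ∃ e : ℤ, bval y = e / 2 ^ m := by
  induction m with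
  | zero => exact ⟨0, by simp [bval]⟩
  | succ m ih =>
    obtain ⟨y₀, y, rfl⟩ : ∃ y₀ y', y = Fin.cons y₀ y' := ⟨y 0, Fin.tail y, by simp⟩
    obtain ⟨e, he⟩ := ih y
    refine ⟨y₀.val * 2 ^ m + e, ?_⟩
    rw [bval_cons, he]
    push_cast
    rw [pow_succ]
    field_simp

/-- Induction step for `exists_walsh_expansion`, prepending a digit y₀. With e = 1 the old function
survives only for y₀ = 0, with e = -1 only for y₀ = 1; w is the new coefficient at index (1, 0, …,
0). The bounds follow the recursion of `rho`. -/
lemma walsh_step {m : ℕ} (C : (Fin m → ZMod 2) → ℝ) (hC : ∀ k, |C k| ≤ rho m k)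
    (e w : ℝ) (he : |e| ≤ 1) (hw : |w| ≤ 1 / 2) :
    ∃ C' : (Fin (m + 1) → ZMod 2) → ℝ, (∀ k, |C' k| ≤ rho (m + 1) k) ∧
      ∀ y₀ y, ∑ k, C' k * wal k (Fin.cons y₀ y) =
        (1 + e * zsign y₀) / 2 * (∑ k, C k * wal k y) + w * zsign y₀ := by
  refine ⟨fun k => (if k 0 = 0 then 1 else e) * C (Fin.tail k) / 2 +
    if k = Fin.cons 1 0 then w else 0, fun k => ?_, fun y₀ y => ?_⟩
  · rw [rho]
    refine (abs_add_le _ _).trans (add_le_add ?_ ?_)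
    · rw [abs_div, abs_mul, abs_two]
      have h1 : |if k 0 = 0 then (1 : ℝ) else e| ≤ 1 := by split_ifs <;> simp [he]
      have := mul_le_mul h1 (hC (Fin.tail k)) (abs_nonneg _) zero_le_one
      linarith
    · split_ifs <;> simp
      linarith
  · rw [sum_digits_succ]
    simp only [wal_cons, Fin.cons_zero, Fin.tail_cons, zero_mul, zsign_zero, one_mul, if_true,
      one_ne_zero, if_false, Fin.cons_inj, zero_ne_one, false_and, true_and, add_zero]
    have : ∀ k, C k / 2 * wal k y + (e * C k / 2 + if k = 0 then w else 0) *
        (zsign y₀ * wal k y) = (1 + e * zsign y₀) / 2 * (C k * wal k y) +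
          (if k = 0 then w * zsign y₀ else 0) := by
      intro k
      by_cases hk : k = 0
      · simp [hk]; ring
      · simp [hk]; ring
    simp only [this, Finset.sum_add_distrib, ← Finset.mul_sum]
    simp

/-- The Walsh expansion of the centred indicator of `[0, c / 2ᵐ)`. -/
lemma exists_walsh_expansion (m c : ℕ) (hc : c ≤ 2 ^ m) :
    ∃ C : (Fin m → ZMod 2) → ℝ, (∀ k, |C k| ≤ rho m k) ∧
      ∀ y, (c : ℝ) / 2 ^ m - (if bval y < c / 2 ^ m then 1 else 0) = ∑ k, C k * wal k y := by
  induction m generalizing c with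
  | zero =>
    refine ⟨0, by simp [rho], fun y => ?_⟩
    have : c = 0 ∨ c = 1 := by simp at hc; omega
    rcases this with rfl | rfl <;> simp [bval]
  | succ m ih =>
    have h2 : (0 : ℝ) < 2 ^ m := by positivity
    -- The position of the endpoint relative to 1/2 decides for which first digit the indicator
    -- still depends on the rest: y₀ = 0 here (e = 1), y₀ = 1 in the other case (e = -1). For the
    -- other value of y₀ the centred indicator is constant, which determines w.
    rcases le_or_gt c (2 ^ m) with h | h
    · obtain ⟨C, hC, hCy⟩ := ih c h
      have hz : (c : ℝ) / 2 ^ m ≤ 1 := by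
        rw [div_le_one h2]; exact_mod_cast h
      have hz0 : 0 ≤ (c : ℝ) / 2 ^ m := by positivity
      have hzz : (c : ℝ) / 2 ^ (m + 1) = c / 2 ^ m / 2 := by rw [pow_succ]; field_simp
      obtain ⟨C', hC', hCy'⟩ := walsh_step C hC 1 (-(c / 2 ^ m / 2)) (by simp)
        (by rw [abs_neg, abs_of_nonneg (by positivity)]; linarith)
      refine ⟨C', hC', fun y => ?_⟩
      obtain ⟨y₀, y, rfl⟩ : ∃ y₀ y', y = Fin.cons y₀ y' := ⟨y 0, Fin.tail y, by simp⟩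
      rw [hCy', ← hCy, bval_cons, hzz]
      have hy := bval_nonneg y
      generalize (c : ℝ) / 2 ^ m = z at *
      rcases eq_zero_or_eq_one y₀ with rfl | rfl
      · have : ((0 : ZMod 2).val + bval y) / 2 < z / 2 ↔ bval y < z := by
          simp
          constructor <;> intro _ <;> linarith
        simp only [this, zsign_zero]
        ring
      · have : ¬ ((1 : ZMod 2).val + bval y) / 2 < z / 2 := by
          simp [ZMod.val_one]; linarith
        simp only [this, zsign_one, if_false]
        ring
    · obtain ⟨c, rfl⟩ := Nat.exists_eq_add_of_le h.le
      have hc' : c ≤ 2 ^ m := by rw [pow_succ] at hc; omega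
      obtain ⟨C, hC, hCy⟩ := ih c hc'
      have hz : (c : ℝ) / 2 ^ m ≤ 1 := by
        rw [div_le_one h2]; exact_mod_cast hc'
      have hz0 : 0 ≤ (c : ℝ) / 2 ^ m := by positivity
      have hzz : ((2 ^ m + c : ℕ) : ℝ) / 2 ^ (m + 1) = (1 + c / 2 ^ m) / 2 := by
        rw [pow_succ]; push_cast; field_simp
      obtain ⟨C', hC', hCy'⟩ := walsh_step C hC (-1) (-((1 - c / 2 ^ m) / 2)) (by simp)
        (by rw [abs_neg, abs_of_nonneg (by linarith)]; linarith)
      refine ⟨C', hC', fun y => ?_⟩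
      obtain ⟨y₀, y, rfl⟩ : ∃ y₀ y', y = Fin.cons y₀ y' := ⟨y 0, Fin.tail y, by simp⟩
      rw [hCy', ← hCy, bval_cons, hzz]
      have hy := bval_lt_one y
      generalize (c : ℝ) / 2 ^ m = z at *
      rcases eq_zero_or_eq_one y₀ with rfl | rfl
      · have : ((0 : ZMod 2).val + bval y) / 2 < (1 + z) / 2 := by
          simp; linarith
        simp only [this, zsign_zero, if_true]
        ring
      · have : ((1 : ZMod 2).val + bval y) / 2 < (1 + z) / 2 ↔ bval y < z := by
          simp [ZMod.val_one]
          constructor <;> intro _ <;> linarith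
        simp only [this, zsign_one]
        ring

/-- The function with Walsh coefficients `rho`. -/
def walMajorant {m : ℕ} (y : Fin m → ZMod 2) : ℝ := ∑ k, rho m k * wal k y

lemma walMajorant_zero (m : ℕ) : walMajorant (0 : Fin m → ZMod 2) = m / 2 := by
  simp [walMajorant, sum_rho]

lemma sum_walMajorant (m : ℕ) : ∑ y : Fin m → ZMod 2, walMajorant y = 0 := by
  simp only [walMajorant]
  rw [Finset.sum_comm]
  simp only [← Finset.mul_sum, sum_wal_right]
  simp [rho_zero]

/-- The sum is |H| or 0. This positivity is what permits replacing coefficients by upper bounds term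
by term. -/
lemma sum_addChar_nonneg {H : Type*} [AddGroup H] [Fintype H] (ψ : AddChar H ℝ) :
    0 ≤ ∑ h, ψ h := by
  classical
  rw [AddChar.sum_eq_ite]
  split_ifs <;> positivity

/-- Exponential sums of functions are dominated by those of a majorant of their Walsh series. -/
lemma abs_sum_prod_walsh_le {H ι : Type*} [AddCommGroup H] [Fintype H] [Fintype ι] {m : ℕ}
    (T : ι → H →+ (Fin m → ZMod 2)) (C : ι → (Fin m → ZMod 2) → ℝ)
    (hC : ∀ i k, |C i k| ≤ rho m k) :
    |∑ h, ∏ i, ∑ k, C i k * wal k (T i h)| ≤ ∑ h, ∏ i, walMajorant (T i h) := by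
  classical
  have key : ∀ c : ι → (Fin m → ZMod 2) → ℝ, ∑ h, ∏ i, ∑ k, c i k * wal k (T i h) =
      ∑ κ : ι → Fin m → ZMod 2, (∏ i, c i (κ i)) * ∑ h, ∏ i, wal (κ i) (T i h) := by
    intro c
    simp only [Finset.prod_univ_sum, Finset.prod_mul_distrib, Fintype.piFinset_univ]
    rw [Finset.sum_comm]
    simp only [Finset.mul_sum]
  simp only [walMajorant]
  rw [key, key]
  refine (Finset.abs_sum_le_sum_abs _ _).trans (Finset.sum_le_sum fun κ _ => ?_)
  -- For fixed κ the product of Walsh functions is a real character of H, because every `T i` is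
  -- additive.
  have hpos : 0 ≤ ∑ h, ∏ i, wal (κ i) (T i h) :=
    sum_addChar_nonneg (H := H)
      { toFun := fun h => ∏ i, wal (κ i) (T i h)
        map_zero_eq_one' := by simp
        map_add_eq_mul' := fun x y => by simp [wal_add, Finset.prod_mul_distrib] }
  rw [abs_mul, abs_of_nonneg hpos, Finset.abs_prod]
  exact mul_le_mul_of_nonneg_right
    (Finset.prod_le_prod (fun _ _ => abs_nonneg _) fun i _ => hC i _) hpos

/-! ### Laurent expansions of rational functions -/

lemma toLaurent_eq_sum (p : (ZMod 2)[X]) :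
    toLaurent p = ∑ n ∈ Finset.range (p.natDegree + 1), HahnSeries.single (-(n : ℤ)) (p.coeff n) := by
  rw [toLaurent, Polynomial.aeval_eq_sum_range]
  refine Finset.sum_congr rfl fun n _ => ?_
  rw [HahnSeries.single_pow]
  rcases eq_zero_or_eq_one (p.coeff n) with h | h <;> simp [h, Algebra.smul_def]

lemma toLaurent_coeff_of_pos (p : (ZMod 2)[X]) {k : ℤ} (hk : 0 < k) :
    (toLaurent p).coeff k = 0 := by
  rw [toLaurent_eq_sum, HahnSeries.coeff_sum]
  refine Finset.sum_eq_zero fun n _ => HahnSeries.coeff_single_of_ne ?_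
  omega

lemma toLaurent_coeff_neg (p : (ZMod 2)[X]) (n : ℕ) :
    (toLaurent p).coeff (-(n : ℤ)) = p.coeff n := by
  rw [toLaurent_eq_sum, HahnSeries.coeff_sum]
  simp only [HahnSeries.coeff_single, neg_inj, Nat.cast_inj, Finset.sum_ite_eq, Finset.mem_range]
  split_ifs with h
  · rfl
  · exact (Polynomial.coeff_eq_zero_of_natDegree_lt (by omega)).symm

lemma toLaurent_ne_zero {p : (ZMod 2)[X]} (hp : p ≠ 0) : toLaurent p ≠ 0 := by
  intro h
  have := toLaurent_coeff_neg p p.natDegree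
  rw [h, Polynomial.coeff_natDegree] at this
  exact hp (Polynomial.leadingCoeff_eq_zero.mp (by simpa using this.symm))

lemma toLaurent_order {p : (ZMod 2)[X]} (hp : p ≠ 0) :
    (toLaurent p).order = -(p.natDegree : ℤ) := by
  have h0 : (toLaurent p).coeff (toLaurent p).order ≠ 0 :=
    HahnSeries.coeff_order_eq_zero.not.mpr (toLaurent_ne_zero hp)
  refine le_antisymm (HahnSeries.order_le_of_coeff_ne_zero ?_) ?_
  · rw [toLaurent_coeff_neg]
    simpa using hp
  · have hk : (toLaurent p).order ≤ 0 := by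
      by_contra! h
      exact h0 (toLaurent_coeff_of_pos p h)
    obtain ⟨n, hn⟩ := Int.exists_eq_neg_ofNat hk
    rw [hn, toLaurent_coeff_neg] at h0
    rw [hn]
    have := Polynomial.le_natDegree_of_ne_zero h0
    omega

/-- The first `m` digits of the fractional part of a Laurent series. -/
def digits (m : ℕ) (L : LaurentSeries (ZMod 2)) : Fin m → ZMod 2 := fun j => L.coeff ((j : ℤ) + 1)

lemma bval_digits (m : ℕ) (L : LaurentSeries (ZMod 2)) : bval (digits m L) = fracPart m L := by
  rw [bval, fracPart, ← Finset.Ico_add_one_right_eq_Icc, Finset.sum_Ico_eq_sum_range,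
    Finset.sum_range]
  refine Finset.sum_congr rfl fun j _ => ?_
  simp [digits, add_comm]

/-- With r the nonzero remainder of p modulo f, the series r / f has order deg f - deg r, which lies
between 1 and deg f. The polynomial quotient has no coefficients at positive indices, so this
leading digit survives among the first deg f. -/
lemma digits_div_ne_zero {f p : (ZMod 2)[X]} (hf : f ≠ 0) (hp : ¬ f ∣ p) :
    digits f.natDegree (toLaurent p / toLaurent f) ≠ 0 := by
  have hLf := toLaurent_ne_zero hf
  set r := p % f with hr
  have hr0 : r ≠ 0 := fun h => hp (EuclideanDomain.mod_eq_zero.mp h)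
  have hdeg : r.natDegree < f.natDegree := by
    refine Polynomial.natDegree_lt_natDegree hr0 ?_
    exact Polynomial.degree_mod_lt p hf
  have hsplit : toLaurent p / toLaurent f = toLaurent (p / f) + toLaurent r / toLaurent f := by
    rw [div_eq_iff hLf, add_mul, div_mul_cancel₀ _ hLf, ← map_mul, ← map_add]
    congr 1
    rw [mul_comm, hr, EuclideanDomain.div_add_mod]
  set R := toLaurent r / toLaurent f with hR
  have hR0 : R ≠ 0 := div_ne_zero (toLaurent_ne_zero hr0) hLf
  have hmul : R * toLaurent f = toLaurent r := div_mul_cancel₀ _ hLf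
  have hord : R.order = (f.natDegree : ℤ) - r.natDegree := by
    have := HahnSeries.order_mul hR0 hLf
    rw [hmul, toLaurent_order hr0, toLaurent_order hf] at this
    omega
  intro h
  have hj : f.natDegree - r.natDegree - 1 < f.natDegree := by omega
  have h1 := congrFun h ⟨_, hj⟩
  have hcast : ((f.natDegree - r.natDegree - 1 : ℕ) : ℤ) + 1 = R.order := by
    rw [hord]; omega
  simp only [digits, Pi.zero_apply, hcast] at h1
  rw [hsplit, HahnSeries.coeff_add, toLaurent_coeff_of_pos _ (by rw [hord]; omega), zero_add] at h1
  exact hR0 (HahnSeries.coeff_order_eq_zero.mp h1)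

/-- The digits of `h g / f`, as an additive function of `h`. -/
def latticeDigits (f g : (ZMod 2)[X]) (m : ℕ) : (ZMod 2)[X] →+ (Fin m → ZMod 2) where
  toFun h := digits m (toLaurent (h * g) / toLaurent f)
  map_zero' := by ext j; simp [digits]
  map_add' x y := by ext j; simp [digits, add_mul, add_div]

/-- Transfers additivity in h to additivity in the generator g. -/
lemma latticeDigits_comm (f g h : (ZMod 2)[X]) (m : ℕ) :
    latticeDigits f g m h = latticeDigits f h m g := by
  simp [latticeDigits, mul_comm]

/-! ### Averaging over generating vectors -/

lemma card_G (m : ℕ) : Fintype.card (G m) = 2 ^ m := by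
  rw [Fintype.card_congr (Polynomial.degreeLTEquiv (ZMod 2) m).toEquiv]
  simp

lemma not_dvd_of_mem_G {f : (ZMod 2)[X]} {h : G f.natDegree} (hh : h ≠ 0) :
    ¬ f ∣ (h : (ZMod 2)[X]) := by
  intro hd
  have h0 : (h : (ZMod 2)[X]) ≠ 0 := by simpa using hh
  have h1 := Polynomial.mem_degreeLT.mp h.2
  have h2 := Polynomial.natDegree_le_of_dvd hd h0
  rw [← Polynomial.natDegree_lt_iff_degree_lt h0] at h1
  omega

/-- If two generators give equal digits, f divides h times their difference; f is prime and both
factors have degree below deg f, so the difference is 0. Both sides have 2ᵐ elements. -/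
lemma latticeDigits_bijective {f : (ZMod 2)[X]} (hf : Irreducible f) {h : G f.natDegree}
    (hh : h ≠ 0) :
    Function.Bijective fun g : G f.natDegree =>
      latticeDigits f (g : (ZMod 2)[X]) f.natDegree (h : (ZMod 2)[X]) := by
  rw [Fintype.bijective_iff_injective_and_card]
  refine ⟨fun x y hxy => ?_, by rw [card_G]; simp⟩
  by_contra hne
  have hxy' : latticeDigits f h f.natDegree ((x - y : G f.natDegree) : (ZMod 2)[X]) = 0 := by
    rw [Submodule.coe_sub, map_sub, sub_eq_zero, latticeDigits_comm, latticeDigits_comm f h y]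
    exact hxy
  refine digits_div_ne_zero hf.ne_zero (fun hd => ?_) hxy'
  rcases hf.prime.dvd_or_dvd hd with hd | hd
  · exact not_dvd_of_mem_G (sub_ne_zero.mpr hne) hd
  · exact not_dvd_of_mem_G hh hd

lemma sum_sum_prod_walMajorant {s : ℕ} {f : (ZMod 2)[X]} (hf : Irreducible f)
    (u : Finset (Fin s)) (hu : u.Nonempty) :
    ∑ g : Fin s → G f.natDegree, ∑ h : G f.natDegree,
      ∏ i ∈ u, walMajorant (latticeDigits f (g i) f.natDegree h) =
        (2 ^ f.natDegree) ^ s * ((f.natDegree : ℝ) / 2) ^ u.card := by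
  rw [Finset.sum_comm, Finset.sum_eq_single 0]
  · simp [walMajorant_zero, card_G, div_pow]
  · intro h _ hh
    have h1 : ∀ g : Fin s → G f.natDegree,
        ∏ i ∈ u, walMajorant (latticeDigits f (g i) f.natDegree h) =
          ∏ i, if i ∈ u then walMajorant (latticeDigits f (g i) f.natDegree h) else 1 := by
      intro g
      simp
    simp only [h1]
    have h2 := Finset.prod_univ_sum (fun _ : Fin s => (Finset.univ : Finset (G f.natDegree)))
      (fun i g => if i ∈ u then walMajorant (latticeDigits f g f.natDegree h) else (1 : ℝ))
    rw [Fintype.piFinset_univ] at h2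
    -- For h ≠ 0 the coordinates of g are independent, so the sum over g factors, and any i ∈ u
    -- supplies a zero factor.
    rw [← h2]
    obtain ⟨i, hi⟩ := hu
    refine Finset.prod_eq_zero (Finset.mem_univ i) ?_
    simp only [hi, if_true]
    rw [(latticeDigits_bijective hf hh).sum_comp (fun y => walMajorant y), sum_walMajorant]
  · simp

/-! ### The local discrepancy of a polynomial lattice -/

lemma abs_prod_sub_prod_le {ι : Type*} (u : Finset ι) (x y : ι → ℝ) (hx : ∀ i ∈ u, |x i| ≤ 1)
    (hy : ∀ i ∈ u, |y i| ≤ 1) :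
    |∏ i ∈ u, x i - ∏ i ∈ u, y i| ≤ ∑ i ∈ u, |x i - y i| := by
  classical
  induction u using Finset.induction_on with
  | empty => simp
  | insert a u ha ih =>
    rw [Finset.prod_insert ha, Finset.prod_insert ha, Finset.sum_insert ha]
    have ih' := ih (fun i hi => hx i (Finset.mem_insert_of_mem hi))
      (fun i hi => hy i (Finset.mem_insert_of_mem hi))
    have h1 := hx a (Finset.mem_insert_self a u)
    have h2 : |∏ i ∈ u, y i| ≤ 1 := by
      rw [Finset.abs_prod]
      exact Finset.prod_le_one (fun _ _ => abs_nonneg _)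
        fun i hi => hy i (Finset.mem_insert_of_mem hi)
    calc |x a * ∏ i ∈ u, x i - y a * ∏ i ∈ u, y i|
        = |(x a - y a) * ∏ i ∈ u, y i + x a * (∏ i ∈ u, x i - ∏ i ∈ u, y i)| := by
          congr 1; ring
      _ ≤ |x a - y a| * |∏ i ∈ u, y i| + |x a| * |∏ i ∈ u, x i - ∏ i ∈ u, y i| := by
          rw [← abs_mul, ← abs_mul]; exact abs_add_le _ _
      _ ≤ |x a - y a| + ∑ i ∈ u, |x i - y i| :=
          add_le_add (mul_le_of_le_one_right (abs_nonneg _) h2)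
            ((mul_le_of_le_one_left (abs_nonneg _) h1).trans ih')

/-- Since `bval y` is itself a multiple of 2⁻ᵐ, rounding z up to the next such multiple does not
affect the strict comparison. -/
lemma exists_dyadic_above (m : ℕ) {z : ℝ} (hz0 : 0 ≤ z) (hz1 : z ≤ 1) :
    ∃ c : ℕ, c ≤ 2 ^ m ∧ |z - c / 2 ^ m| ≤ 1 / 2 ^ m ∧
      ∀ y : Fin m → ZMod 2, bval y < z ↔ bval y < c / 2 ^ m := by
  have h2 : (0 : ℝ) < 2 ^ m := by positivity
  have hcast : ((⌈2 ^ m * z⌉₊ : ℝ)) = ((⌈2 ^ m * z⌉ : ℤ) : ℝ) :=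
    natCast_ceil_eq_intCast_ceil (by positivity)
  refine ⟨⌈2 ^ m * z⌉₊, Nat.ceil_le.mpr ?_, ?_, fun y => ?_⟩
  · push_cast
    nlinarith
  · have h3 := Nat.le_ceil (2 ^ m * z)
    have h4 := Nat.ceil_lt_add_one (a := 2 ^ m * z) (by positivity)
    have : z - ⌈2 ^ m * z⌉₊ / 2 ^ m = (2 ^ m * z - ⌈2 ^ m * z⌉₊) / 2 ^ m := by field_simp
    rw [this, abs_div, abs_of_pos h2]
    refine div_le_div_of_nonneg_right ?_ h2.le
    rw [abs_le]
    constructor <;> linarith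
  · obtain ⟨e, he⟩ := exists_bval_eq y
    rw [he, hcast, div_lt_div_iff_of_pos_right h2, Int.cast_lt, Int.lt_ceil, div_lt_iff₀' h2]

lemma abs_sub_ite_le_one {z : ℝ} (hz0 : 0 ≤ z) (hz1 : z ≤ 1) (p : Prop) [Decidable p] :
    |z - if p then 1 else 0| ≤ 1 := by
  split_ifs <;> rw [abs_le] <;> constructor <;> linarith

/-- The summand `u.card` is the total rounding cost: 2ᵐ points, each changed by at most |u| / 2ᵐ. -/
lemma abs_sum_prod_discrepancy_le {s : ℕ} (g : Fin s → (ZMod 2)[X]) (f : (ZMod 2)[X])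
    (u : Finset (Fin s)) (z : Fin s → ℝ) (hz : ∀ i, z i ∈ Set.Icc (0 : ℝ) 1) :
    |∑ h : G f.natDegree, ∏ i ∈ u, (z i - if polyLattice g f h i < z i then 1 else 0)| ≤
      u.card + ∑ h : G f.natDegree,
        ∏ i ∈ u, walMajorant (latticeDigits f (g i) f.natDegree h) := by
  set m := f.natDegree with hm
  choose c hc hcz hcy using fun i => exists_dyadic_above m (hz i).1 (hz i).2
  choose C hC hCy using fun i => exists_walsh_expansion m (c i) (hc i)
  have hlat : ∀ h i, polyLattice g f h i = bval (latticeDigits f (g i) m h) := by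
    intro h i
    exact (bval_digits _ _).symm
  have hdy : ∀ i, (c i : ℝ) / 2 ^ m ≤ 1 := fun i => by
    rw [div_le_one (by positivity)]; exact_mod_cast hc i
  set B : G m → Fin s → ℝ := fun h i =>
    (c i : ℝ) / 2 ^ m - if bval (latticeDigits f (g i) m h) < c i / 2 ^ m then 1 else 0 with hB
  have hmain : |∑ h, ∏ i ∈ u, B h i| ≤
      ∑ h : G m, ∏ i ∈ u, walMajorant (latticeDigits f (g i) m h) := by
    have := abs_sum_prod_walsh_le (ι := u) (H := G m)
      (fun i => (latticeDigits f (g i) m).comp (G m).toAddSubgroup.subtype)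
      (fun i => C i) (fun i => hC i)
    simp only [hB, hCy]
    simp only [← Finset.prod_coe_sort u]
    exact this
  have hdiff : ∀ h : G m, |∏ i ∈ u, (z i - if polyLattice g f h i < z i then 1 else 0) -
      ∏ i ∈ u, B h i| ≤ u.card * (1 / 2 ^ m) := by
    intro h
    refine (abs_prod_sub_prod_le u _ _
      (fun i _ => abs_sub_ite_le_one (hz i).1 (hz i).2 _)
      (fun i _ => abs_sub_ite_le_one (by positivity) (hdy i) _)).trans ?_
    rw [← nsmul_eq_mul]
    refine Finset.sum_le_card_nsmul _ _ _ fun i _ => ?_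
    simp only [hlat, hcy]
    rw [sub_sub_sub_cancel_right]
    exact hcz i
  calc _ = |∑ h : G m, (∏ i ∈ u, (z i - if polyLattice g f h i < z i then 1 else 0) -
        ∏ i ∈ u, B h i) + ∑ h, ∏ i ∈ u, B h i| := by
        rw [Finset.sum_sub_distrib, sub_add_cancel]
    _ ≤ ∑ _h : G m, (u.card : ℝ) * (1 / 2 ^ m) +
        ∑ h : G m, ∏ i ∈ u, walMajorant (latticeDigits f (g i) m h) := by
        refine (abs_add_le _ _).trans (add_le_add ?_ hmain)
        exact (Finset.abs_sum_le_sum_abs _ _).trans (Finset.sum_le_sum fun h _ => hdiff h)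
    _ = _ := by
        rw [Finset.sum_const, Finset.card_univ, card_G, nsmul_eq_mul]
        push_cast
        field_simp
        rfl

open MeasureTheory

/-! ### Integral representation of functions with mixed partial derivatives -/

/-- The kernel `μ((-∞, t]) - 1_{ξ < t}`. -/
def discKernel (μ : Measure ℝ) (ξ t : ℝ) : ℝ := μ.real (Set.Iic t) - if ξ < t then 1 else 0

lemma measurable_discKernel (μ : Measure ℝ) [IsProbabilityMeasure μ] (ξ : ℝ) :
    Measurable (discKernel μ ξ) := by
  refine Measurable.sub (Monotone.measurable fun x y h => ?_)
    (Measurable.ite measurableSet_Ioi measurable_const measurable_const)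
  exact measureReal_mono (Set.Iic_subset_Iic.mpr h)

lemma abs_discKernel_le (μ : Measure ℝ) [IsProbabilityMeasure μ] (ξ t : ℝ) :
    |discKernel μ ξ t| ≤ 1 :=
  abs_sub_ite_le_one measureReal_nonneg measureReal_le_one _

lemma integrable_of_abs_le {α : Type*} [MeasurableSpace α] {μ : Measure α} [IsFiniteMeasure μ]
    {f : α → ℝ} (hf : Measurable f) {M : ℝ} (hM : ∀ x, |f x| ≤ M) : Integrable f μ :=
  Integrable.of_bound hf.aestronglyMeasurable M (ae_of_all _ hM)

/-- The derivative need not be continuous: existence everywhere, measurability and boundedness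
suffice for the fundamental theorem of calculus. -/
lemma setIntegral_Ioc_deriv {a b : ℝ} {g g' : ℝ → ℝ} {M : ℝ}
    (hg : ∀ t ∈ Set.Icc a b, HasDerivWithinAt g (g' t) (Set.Icc a b) t) (hg' : Measurable g')
    (hM : ∀ t, |g' t| ≤ M) {y : ℝ} (hy : y ∈ Set.Icc a b) :
    ∫ t in Set.Ioc y b, g' t = g b - g y := by
  rw [← intervalIntegral.integral_of_le hy.2]
  refine intervalIntegral.integral_eq_sub_of_hasDeriv_right_of_le hy.2 ?_ ?_ ?_
  · exact fun t ht => ((hg t ⟨hy.1.trans ht.1, ht.2⟩).continuousWithinAt).mono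
      (Set.Icc_subset_Icc_left hy.1)
  · intro t ht
    have hnhds : Set.Icc a b ∈ nhds t := Icc_mem_nhds (hy.1.trans_lt ht.1) ht.2
    exact ((hg t ⟨hy.1.trans ht.1.le, ht.2.le⟩).hasDerivAt hnhds).hasDerivWithinAt
  · rw [intervalIntegrable_iff_integrableOn_Ioc_of_le hy.2]
    exact integrable_of_abs_le hg' hM

/-- The one-dimensional representation formula. -/
lemma eq_integral_add_integral_deriv {a b : ℝ} {μ : Measure ℝ} [IsProbabilityMeasure μ]
    (hμ : ∀ᵐ y ∂μ, y ∈ Set.Icc a b) {g g' : ℝ → ℝ} {M₀ M : ℝ}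
    (hg : ∀ t ∈ Set.Icc a b, HasDerivWithinAt g (g' t) (Set.Icc a b) t)
    (hgm : Measurable g) (hM₀ : ∀ t, |g t| ≤ M₀) (hg' : Measurable g') (hM : ∀ t, |g' t| ≤ M)
    {ξ : ℝ} (hξ : ξ ∈ Set.Icc a b) :
    g ξ = ∫ y, g y ∂μ + ∫ t in Set.Icc a b, g' t * discKernel μ ξ t := by
  -- Integrating H over t gives g ξ - g y, and integrating over y gives g' times the kernel; Fubini
  -- equates the two iterated integrals.
  set H : ℝ → ℝ → ℝ := fun y t => g' t * ((if y ≤ t then 1 else 0) - if ξ < t then 1 else 0)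
    with hH
  have hHm : Measurable (Function.uncurry H) := by
    refine (hg'.comp measurable_snd).mul (Measurable.sub ?_ ?_)
    · exact Measurable.ite (measurableSet_le measurable_fst measurable_snd)
        measurable_const measurable_const
    · exact Measurable.ite (measurableSet_lt measurable_const measurable_snd)
        measurable_const measurable_const
  have hHb : ∀ p, |Function.uncurry H p| ≤ M := by
    rintro ⟨y, t⟩
    refine le_trans ?_ (hM t)
    simp only [Function.uncurry, hH, abs_mul]
    refine mul_le_of_le_one_right (abs_nonneg _) ?_
    split_ifs <;> simp
  have hswap := integral_integral_swap (μ := μ) (ν := volume.restrict (Set.Icc a b)) (f := H)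
    (integrable_of_abs_le hHm hHb)
  have hleft : ∀ᵐ y ∂μ, ∫ t in Set.Icc a b, H y t = g ξ - g y := by
    filter_upwards [hμ] with y hy
    have hi : ∀ z ∈ Set.Icc a b, ∫ t in Set.Icc a b, (Set.Ioi z).indicator g' t = g b - g z := by
      intro z hz
      rw [← setIntegral_Ioc_deriv hg hg' hM hz, setIntegral_indicator measurableSet_Ioi]
      congr 2
      ext t
      simp only [Set.mem_inter_iff, Set.mem_Icc, Set.mem_Ioi, Set.mem_Ioc]
      exact ⟨fun h => ⟨h.2, h.1.2⟩, fun h => ⟨⟨hz.1.trans h.1.le, h.2⟩, h.1⟩⟩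
    have hint : ∀ z, Integrable ((Set.Ioi z).indicator g') (volume.restrict (Set.Icc a b)) :=
      fun z => (integrable_of_abs_le hg' hM).indicator measurableSet_Ioi
    -- H uses y ≤ t, to match μ((-∞, t]), while the integral over t uses y < t; they differ only at
    -- the null point t = y.
    have hne : ∀ᵐ t ∂(volume.restrict (Set.Icc a b)), t ≠ y :=
      ae_restrict_of_ae (Measure.ae_ne volume y)
    have hcong : ∀ᵐ t ∂(volume.restrict (Set.Icc a b)),
        H y t = (Set.Ioi y).indicator g' t - (Set.Ioi ξ).indicator g' t := by
      filter_upwards [hne] with t ht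
      have : y ≤ t ↔ y < t := ⟨fun h => lt_of_le_of_ne h ht.symm, le_of_lt⟩
      simp only [hH, this, Set.indicator, Set.mem_Ioi]
      split_ifs <;> ring
    rw [integral_congr_ae hcong, integral_sub (hint y) (hint ξ), hi y hy, hi ξ hξ]
    ring
  have hright : ∀ t, ∫ y, H y t ∂μ = g' t * discKernel μ ξ t := by
    intro t
    have h1 : ∀ y, (if y ≤ t then (1 : ℝ) else 0) = (Set.Iic t).indicator 1 y := by
      intro y; simp [Set.indicator]
    simp only [hH, h1]
    rw [integral_const_mul, integral_sub, integral_indicator_one measurableSet_Iic]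
    · simp [discKernel]
    · exact (integrable_const (1 : ℝ)).indicator measurableSet_Iic
    · exact integrable_const _
  rw [integral_congr_ae hleft] at hswap
  simp only [hright] at hswap
  rw [← hswap, integral_sub (integrable_const _) (integrable_of_abs_le hgm hM₀)]
  simp

/-- Replacing one coordinate of a product-distributed vector. -/
lemma measurePreserving_update {s : ℕ} (ν : Fin s → Measure ℝ) [∀ j, IsFiniteMeasure (ν j)]
    (i : Fin s) [IsProbabilityMeasure (ν i)] (ρ : Measure ℝ) [IsFiniteMeasure ρ] :
    MeasurePreserving (fun p : (Fin s → ℝ) × ℝ => Function.update p.1 i p.2)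
      ((Measure.pi ν).prod ρ) (Measure.pi (Function.update ν i ρ)) := by
  have hmeas : Measurable fun p : (Fin s → ℝ) × ℝ => Function.update p.1 i p.2 :=
    measurable_update'
  have : ∀ j, IsFiniteMeasure (Function.update ν i ρ j) := by
    intro j
    by_cases h : j = i
    · subst h; simpa
    · simpa [h] using inferInstanceAs (IsFiniteMeasure (ν j))
  refine ⟨hmeas, (Measure.pi_eq fun B hB => ?_).symm⟩
  have hpre : (fun p : (Fin s → ℝ) × ℝ => Function.update p.1 i p.2) ⁻¹' (Set.univ.pi B) =
      (Set.univ.pi (Function.update B i Set.univ)) ×ˢ B i := by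
    ext ⟨x, t⟩
    simp only [Set.mem_preimage, Set.mem_pi, Set.mem_univ, true_implies, Set.mem_prod]
    constructor
    · intro h
      refine ⟨fun j => ?_, by simpa using h i⟩
      by_cases hj : j = i
      · subst hj; simp
      · simpa [hj] using h j
    · rintro ⟨h1, h2⟩ j
      by_cases hj : j = i
      · subst hj; simpa using h2
      · simpa [hj] using h1 j
  rw [Measure.map_apply hmeas (MeasurableSet.univ_pi hB), hpre, Measure.prod_prod, Measure.pi_pi,
    ← Finset.mul_prod_erase Finset.univ _ (Finset.mem_univ i),
    ← Finset.mul_prod_erase Finset.univ (fun j => Function.update ν i ρ j (B j))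
      (Finset.mem_univ i)]
  simp only [Function.update_self, measure_univ, one_mul]
  rw [mul_comm]
  congr 1
  refine Finset.prod_congr rfl fun j hj => ?_
  simp [Finset.ne_of_mem_erase hj]

/-- Averaging the i-th coordinate over ρ changes its law from ν i to ρ. It serves both for ρ = μ i
and for Lebesgue measure on the i-th edge. -/
lemma integrable_and_integral_update {s : ℕ} (ν : Fin s → Measure ℝ)
    [∀ j, IsFiniteMeasure (ν j)] (i : Fin s) [IsProbabilityMeasure (ν i)] (ρ : Measure ℝ)
    [IsFiniteMeasure ρ] {f : (Fin s → ℝ) → ℝ} (hf : Measurable f) {M : ℝ} (hM : ∀ x, |f x| ≤ M) :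
    Integrable (fun t => ∫ τ, f (Function.update t i τ) ∂ρ) (Measure.pi ν) ∧
      ∫ t, ∫ τ, f (Function.update t i τ) ∂ρ ∂(Measure.pi ν) =
        ∫ t, f t ∂(Measure.pi (Function.update ν i ρ)) := by
  have hp := measurePreserving_update ν i ρ
  have hint : Integrable (fun p : (Fin s → ℝ) × ℝ => f (Function.update p.1 i p.2))
      ((Measure.pi ν).prod ρ) :=
    integrable_of_abs_le (hf.comp hp.measurable) fun _ => hM _
  refine ⟨hint.integral_prod_left, ?_⟩
  rw [← hp.map_eq, integral_map hp.measurable.aemeasurable hf.aestronglyMeasurable,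
    integral_prod _ hint]

/-- The product of the measures `μ i`, `i ∉ u`, and of Lebesgue measure on `[a i, b i]`,
`i ∈ u`. -/
def mixedMeasure {s : ℕ} (a b : Fin s → ℝ) (μ : Fin s → Measure ℝ) (u : Finset (Fin s))
    (i : Fin s) : Measure ℝ :=
  if i ∈ u then volume.restrict (Set.Icc (a i) (b i)) else μ i

instance {s : ℕ} (a b : Fin s → ℝ) (μ : Fin s → Measure ℝ) [∀ i, IsProbabilityMeasure (μ i)]
    (u : Finset (Fin s)) (i : Fin s) : IsFiniteMeasure (mixedMeasure a b μ u i) := by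
  unfold mixedMeasure; split_ifs <;> infer_instance

/-- The data of a function on a box and its mixed partial derivatives, extended to `ℝˢ`. -/
structure IsDerivFamily {s : ℕ} (a b : Fin s → ℝ) (M : Finset (Fin s) → ℝ)
    (D : Finset (Fin s) → (Fin s → ℝ) → ℝ) : Prop where
  measurable : ∀ u, Measurable (D u)
  abs_le : ∀ u x, |D u x| ≤ M u
  hasDeriv : ∀ u i, (∀ j ∈ u, i < j) → ∀ x, ∀ t ∈ Set.Icc (a i) (b i),
    HasDerivWithinAt (fun t => D u (Function.update x i t)) (D (insert i u) (Function.update x i t))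
      (Set.Icc (a i) (b i)) t

lemma measurable_piecewise {s : ℕ} (S : Finset (Fin s)) (x : Fin s → ℝ) :
    Measurable fun t : Fin s → ℝ => S.piecewise t x := by
  refine measurable_pi_lambda _ fun j => ?_
  by_cases hj : j ∈ S
  · simpa [hj] using measurable_pi_apply j
  · simp [hj]

lemma measurable_prod_discKernel {s : ℕ} (μ : Fin s → Measure ℝ)
    [∀ i, IsProbabilityMeasure (μ i)] (u : Finset (Fin s)) (x : Fin s → ℝ) :
    Measurable fun t : Fin s → ℝ => ∏ i ∈ u, discKernel (μ i) (x i) (t i) :=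
  Finset.measurable_fun_prod _ fun i _ =>
    (measurable_discKernel (μ i) (x i)).comp (measurable_pi_apply i)

lemma abs_prod_discKernel_le {s : ℕ} (μ : Fin s → Measure ℝ)
    [∀ i, IsProbabilityMeasure (μ i)] (u : Finset (Fin s)) (x t : Fin s → ℝ) :
    |∏ i ∈ u, discKernel (μ i) (x i) (t i)| ≤ 1 := by
  rw [Finset.abs_prod]
  exact Finset.prod_le_one (fun _ _ => abs_nonneg _) fun i _ => abs_discKernel_le _ _ _

/-- The multivariate representation formula, with the variables in `S` integrated out. -/
lemma IsDerivFamily.eq_sum_integral_piecewise {s : ℕ} {a b : Fin s → ℝ} {M : Finset (Fin s) → ℝ}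
    {D : Finset (Fin s) → (Fin s → ℝ) → ℝ} (hD : IsDerivFamily a b M D) (μ : Fin s → Measure ℝ)
    [∀ i, IsProbabilityMeasure (μ i)] (hμ : ∀ i, ∀ᵐ y ∂(μ i), y ∈ Set.Icc (a i) (b i))
    {x : Fin s → ℝ} (hx : x ∈ Set.Icc a b) (S : Finset (Fin s)) :
    D ∅ x = ∑ u ∈ S.powerset, ∫ t, D u (S.piecewise t x) * ∏ i ∈ u, discKernel (μ i) (x i) (t i)
      ∂(Measure.pi (mixedMeasure a b μ u)) := by
  -- Variables enter in decreasing order, since `hasDeriv` only differentiates in a variable below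
  -- all of u.
  induction S using Finset.induction_on_min with
  | empty =>
    have : ∀ i, IsProbabilityMeasure (mixedMeasure a b μ ∅ i) := fun i => by
      simp only [mixedMeasure, Finset.notMem_empty, if_false]; infer_instance
    simp
  | insert i S hi ih =>
    have hiS : i ∉ S := fun h => lt_irrefl _ (hi i h)
    rw [Finset.sum_powerset_insert hiS, ih, ← Finset.sum_add_distrib]
    refine Finset.sum_congr rfl fun u hu => ?_
    have huS := Finset.mem_powerset.mp hu
    have hiu : i ∉ u := fun h => hiS (huS h)
    have hmem : mixedMeasure a b μ u i = μ i := by simp [mixedMeasure, hiu]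
    have : IsProbabilityMeasure (mixedMeasure a b μ u i) := by rw [hmem]; infer_instance
    have hν1 : Function.update (mixedMeasure a b μ u) i (μ i) = mixedMeasure a b μ u := by
      rw [← hmem, Function.update_eq_self]
    have hν2 : Function.update (mixedMeasure a b μ u) i (volume.restrict (Set.Icc (a i) (b i))) =
        mixedMeasure a b μ (insert i u) := by
      funext j
      by_cases hj : j = i
      · subst hj; simp [mixedMeasure]
      · simp [mixedMeasure, hj]
    set G : Finset (Fin s) → (Fin s → ℝ) → ℝ := fun v t =>
      D v ((insert i S).piecewise t x) * ∏ j ∈ v, discKernel (μ j) (x j) (t j) with hG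
    have hGm : ∀ v, Measurable (G v) := fun v =>
      ((hD.measurable v).comp (measurable_piecewise _ x)).mul (measurable_prod_discKernel μ v x)
    have hGb : ∀ v t, |G v t| ≤ M v := by
      intro v t
      simp only [hG, abs_mul]
      exact (mul_le_of_le_one_right (abs_nonneg _) (abs_prod_discKernel_le μ v x t)).trans
        (hD.abs_le v _)
    obtain ⟨hI1, hE1⟩ := integrable_and_integral_update (mixedMeasure a b μ u) i (μ i)
      (hGm u) (hGb u)
    obtain ⟨hI2, hE2⟩ := integrable_and_integral_update (mixedMeasure a b μ u) i
      (volume.restrict (Set.Icc (a i) (b i))) (hGm (insert i u)) (hGb (insert i u))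
    rw [hν1] at hE1
    rw [hν2] at hE2
    rw [← hE1, ← hE2, ← integral_add hI1 hI2]
    refine integral_congr_ae (ae_of_all _ fun t => ?_)
    have hupd : ∀ τ, (insert i S).piecewise (Function.update t i τ) x =
        Function.update (S.piecewise t x) i τ := by
      intro τ
      rw [Finset.piecewise_insert, Function.update_self]
      congr 1
      refine Finset.piecewise_congr _ (fun j hj => ?_) fun _ _ => rfl
      exact Function.update_of_ne (fun h : j = i => hiS (h ▸ hj)) _ _
    have hprod : ∀ τ, ∏ j ∈ u, discKernel (μ j) (x j) (Function.update t i τ j) =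
        ∏ j ∈ u, discKernel (μ j) (x j) (t j) := fun τ =>
      Finset.prod_congr rfl fun j hj => by
        rw [Function.update_of_ne (fun h : j = i => hiu (h ▸ hj))]
    have hself : Function.update (S.piecewise t x) i (x i) = S.piecewise t x := by
      have : S.piecewise t x i = x i := by simp [hiS]
      rw [← this, Function.update_eq_self]
    have hupm : Measurable fun τ => Function.update (S.piecewise t x) i τ := measurable_update _
    -- The one-variable formula in x_i splits the term of u into the terms of u and of `insert i u`.
    have h1 := eq_integral_add_integral_deriv (hμ i)
      (hD.hasDeriv u i (fun j hj => hi j (huS hj)) (S.piecewise t x))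
      ((hD.measurable u).comp hupm) (fun τ => hD.abs_le u _)
      ((hD.measurable (insert i u)).comp hupm) (fun τ => hD.abs_le _ _)
      (ξ := x i) ⟨hx.1 i, hx.2 i⟩
    simp only [hself] at h1
    simp only [hG, hupd, hprod, Finset.prod_insert hiu, Function.update_self]
    rw [h1, add_mul, ← integral_mul_const, ← integral_mul_const]
    congr 1
    simp only [mul_assoc]

/-! ### From the representation formula to an error bound -/

lemma mixedMeasure_ae_mem {s : ℕ} {a b : Fin s → ℝ} (μ : Fin s → Measure ℝ)
    [∀ i, IsProbabilityMeasure (μ i)] (hμ : ∀ i, ∀ᵐ y ∂(μ i), y ∈ Set.Icc (a i) (b i))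
    (u : Finset (Fin s)) :
    ∀ᵐ t ∂(Measure.pi (mixedMeasure a b μ u)), t ∈ Set.Icc a b := by
  have : ∀ i, ∀ᵐ t ∂(Measure.pi (mixedMeasure a b μ u)), t i ∈ Set.Icc (a i) (b i) := by
    intro i
    refine Measure.tendsto_eval_ae_ae.eventually (?_ : ∀ᵐ y ∂(mixedMeasure a b μ u i), _)
    unfold mixedMeasure
    split_ifs
    · exact ae_restrict_mem measurableSet_Icc
    · exact hμ i
  filter_upwards [ae_all_iff.mpr this] with t ht
  exact ⟨fun i => (ht i).1, fun i => (ht i).2⟩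

lemma mixedMeasure_univ {s : ℕ} {a b : Fin s → ℝ} (hab : ∀ i, a i ≤ b i) (μ : Fin s → Measure ℝ)
    [∀ i, IsProbabilityMeasure (μ i)] (u : Finset (Fin s)) :
    (Measure.pi (mixedMeasure a b μ u)).real Set.univ = ∏ i ∈ u, (b i - a i) := by
  rw [measureReal_def, Measure.pi_univ, ENNReal.toReal_prod]
  have : ∀ i, (mixedMeasure a b μ u i Set.univ).toReal = if i ∈ u then b i - a i else 1 := by
    intro i
    unfold mixedMeasure
    split_ifs
    · simp [Real.volume_Icc, hab i]
    · simp
  simp [this]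

/-- A Koksma–Hlawka type inequality. -/
lemma IsDerivFamily.abs_error_le {s : ℕ} {a b : Fin s → ℝ} {M : Finset (Fin s) → ℝ}
    {D : Finset (Fin s) → (Fin s → ℝ) → ℝ} (hD : IsDerivFamily a b M D) (hab : ∀ i, a i ≤ b i)
    (μ : Fin s → Measure ℝ) [∀ i, IsProbabilityMeasure (μ i)]
    (hμ : ∀ i, ∀ᵐ y ∂(μ i), y ∈ Set.Icc (a i) (b i)) {ι : Type*} [Fintype ι] [Nonempty ι]
    (x : ι → Fin s → ℝ) (hx : ∀ n, x n ∈ Set.Icc a b) (Δ : Finset (Fin s) → ℝ)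
    (hΔ : ∀ u, ∀ t ∈ Set.Icc a b,
      |∑ n, ∏ i ∈ u, discKernel (μ i) (x n i) (t i)| ≤ Δ u) :
    |1 / (Fintype.card ι : ℝ) * ∑ n, D ∅ (x n) - ∫ t, D ∅ t ∂(Measure.pi μ)| ≤
      1 / (Fintype.card ι : ℝ) * ∑ u : Finset (Fin s) with u.Nonempty,
        M u * Δ u * ∏ i ∈ u, (b i - a i) := by
  have hN : (0 : ℝ) < Fintype.card ι := by exact_mod_cast Fintype.card_pos
  have hint : ∀ u n, Integrable (fun t => D u t * ∏ i ∈ u, discKernel (μ i) (x n i) (t i))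
      (Measure.pi (mixedMeasure a b μ u)) := by
    intro u n
    refine integrable_of_abs_le (M := M u)
      ((hD.measurable u).mul (measurable_prod_discKernel μ u (x n))) fun t => ?_
    rw [abs_mul]
    exact (mul_le_of_le_one_right (abs_nonneg _) (abs_prod_discKernel_le μ u (x n) t)).trans
      (hD.abs_le u _)
  set I : Finset (Fin s) → ℝ := fun u =>
    ∫ t, D u t * ∑ n, ∏ i ∈ u, discKernel (μ i) (x n i) (t i) ∂(Measure.pi (mixedMeasure a b μ u))
    with hI
  have hsum : ∑ n, D ∅ (x n) = ∑ u, I u := by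
    have : ∀ n, D ∅ (x n) = ∑ u, ∫ t, D u t * ∏ i ∈ u, discKernel (μ i) (x n i) (t i)
        ∂(Measure.pi (mixedMeasure a b μ u)) := by
      intro n
      have := hD.eq_sum_integral_piecewise μ hμ (hx n) Finset.univ
      simpa using this
    simp only [this, hI]
    rw [Finset.sum_comm]
    refine Finset.sum_congr rfl fun u _ => ?_
    rw [← integral_finsetSum _ fun n _ => hint u n]
    simp only [Finset.mul_sum]
  have hempty : I ∅ = Fintype.card ι * ∫ t, D ∅ t ∂(Measure.pi μ) := by
    have : mixedMeasure a b μ ∅ = μ := by funext i; simp [mixedMeasure]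
    simp only [hI, this, Finset.prod_empty, Finset.sum_const, Finset.card_univ, nsmul_eq_mul,
      mul_one]
    rw [integral_mul_const, mul_comm]
  have hIb : ∀ u, |I u| ≤ M u * Δ u * ∏ i ∈ u, (b i - a i) := by
    intro u
    rw [← mixedMeasure_univ hab μ u, ← Real.norm_eq_abs]
    refine norm_integral_le_of_norm_le_const ?_
    filter_upwards [mixedMeasure_ae_mem μ hμ u] with t ht
    rw [norm_mul]
    exact mul_le_mul (hD.abs_le u t) (hΔ u t ht) (norm_nonneg _)
      ((abs_nonneg _).trans (hD.abs_le u t))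
  have hsplit : ∑ u, I u = I ∅ + ∑ u : Finset (Fin s) with u.Nonempty, I u := by
    rw [← Finset.add_sum_erase _ _ (Finset.mem_univ ∅)]
    congr 1
    refine Finset.sum_congr ?_ fun _ _ => rfl
    ext u
    simp [Finset.nonempty_iff_ne_empty]
  have heq : 1 / (Fintype.card ι : ℝ) * ∑ n, D ∅ (x n) - ∫ t, D ∅ t ∂(Measure.pi μ) =
      1 / (Fintype.card ι : ℝ) * ∑ u : Finset (Fin s) with u.Nonempty, I u := by
    rw [hsum, hsplit, hempty]
    field_simp
    ring
  rw [heq, abs_mul, abs_of_pos (by positivity)]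
  refine mul_le_mul_of_nonneg_left ?_ (by positivity)
  exact (Finset.abs_sum_le_sum_abs _ _).trans (Finset.sum_le_sum fun u _ => hIb u)

/-! ### The measure with a given density -/

/-- The measure on `[a, b]` with density `ψ`. -/
def pdfMeasure (ψ : ℝ → ℝ) (a b : ℝ) : Measure ℝ :=
  (volume.restrict (Set.Icc a b)).withDensity fun x => ENNReal.ofReal (ψ x)

lemma IsPDFOn.integrableOn {ψ : ℝ → ℝ} {a b : ℝ} (h : IsPDFOn ψ a b) (hab : a ≤ b) :
    IntegrableOn ψ (Set.Icc a b) := by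
  rw [← intervalIntegrable_iff_integrableOn_Icc_of_le hab]
  -- A non-integrable density would have integral 0 by convention, not 1.
  by_contra hn
  have := intervalIntegral.integral_undef hn
  rw [h.2] at this
  exact one_ne_zero this

lemma IsPDFOn.ae_nonneg {ψ : ℝ → ℝ} {a b : ℝ} (h : IsPDFOn ψ a b) :
    ∀ᵐ x ∂(volume.restrict (Set.Icc a b)), 0 ≤ ψ x := by
  filter_upwards [ae_restrict_mem measurableSet_Icc] with x hx using h.1 x hx

lemma IsPDFOn.pdfMeasure_apply {ψ : ℝ → ℝ} {a b : ℝ} (h : IsPDFOn ψ a b) (hab : a ≤ b)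
    {B : Set ℝ} (hB : MeasurableSet B) :
    pdfMeasure ψ a b B = ENNReal.ofReal (∫ x in B, ψ x ∂(volume.restrict (Set.Icc a b))) := by
  rw [pdfMeasure, withDensity_apply _ hB, ofReal_integral_eq_lintegral_ofReal]
  · exact Integrable.restrict (h.integrableOn hab)
  · exact ae_restrict_of_ae h.ae_nonneg

lemma IsPDFOn.isProbabilityMeasure {ψ : ℝ → ℝ} {a b : ℝ} (h : IsPDFOn ψ a b) (hab : a ≤ b) :
    IsProbabilityMeasure (pdfMeasure ψ a b) := by
  constructor
  rw [h.pdfMeasure_apply hab MeasurableSet.univ, Measure.restrict_univ, integral_Icc_eq_integral_Ioc,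
    ← intervalIntegral.integral_of_le hab, h.2, ENNReal.ofReal_one]

lemma pdfMeasure_ae_mem (ψ : ℝ → ℝ) (a b : ℝ) : ∀ᵐ y ∂(pdfMeasure ψ a b), y ∈ Set.Icc a b :=
  (withDensity_absolutelyContinuous _ _).ae_le (ae_restrict_mem measurableSet_Icc)

lemma IsPDFOn.pdfMeasure_real_Iic {ψ : ℝ → ℝ} {a b : ℝ} (h : IsPDFOn ψ a b) {t : ℝ}
    (ht : t ∈ Set.Icc a b) : (pdfMeasure ψ a b).real (Set.Iic t) = cdfFrom ψ a t := by
  have hab := ht.1.trans ht.2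
  have hset : Set.Iic t ∩ Set.Icc a b = Set.Icc a t := by
    ext x
    simp only [Set.mem_inter_iff, Set.mem_Iic, Set.mem_Icc]
    exact ⟨fun hx => ⟨hx.2.1, hx.1⟩, fun hx => ⟨hx.2, hx.1, hx.2.trans ht.2⟩⟩
  rw [measureReal_def, h.pdfMeasure_apply hab measurableSet_Iic,
    Measure.restrict_restrict measurableSet_Iic, hset, integral_Icc_eq_integral_Ioc, cdfFrom,
    ← intervalIntegral.integral_of_le ht.1, ENNReal.toReal_ofReal]
  exact intervalIntegral.integral_nonneg ht.1 fun x hx => h.1 x ⟨hx.1, hx.2.trans ht.2⟩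

lemma volume_restrict_Icc_pi {s : ℕ} (a b : Fin s → ℝ) :
    (volume : Measure (Fin s → ℝ)).restrict (Set.Icc a b) =
      Measure.pi fun i => volume.restrict (Set.Icc (a i) (b i)) := by
  rw [← Set.pi_univ_Icc, volume_pi, Measure.restrict_pi_pi]

lemma pi_pdfMeasure {s : ℕ} {a b : Fin s → ℝ} (hab : ∀ i, a i ≤ b i) {φ : Fin s → ℝ → ℝ}
    (hφ : ∀ i, IsPDFOn (φ i) (a i) (b i)) :
    Measure.pi (fun i => pdfMeasure (φ i) (a i) (b i)) =
      (volume.restrict (Set.Icc a b)).withDensity fun x => ENNReal.ofReal (∏ i, φ i (x i)) := by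
  have := fun i => (hφ i).isProbabilityMeasure (hab i)
  refine Measure.pi_eq fun B hB => ?_
  have hnn : ∀ i, 0 ≤ ∫ x in B i, φ i x ∂(volume.restrict (Set.Icc (a i) (b i))) := fun i =>
    integral_nonneg_of_ae (ae_restrict_of_ae (hφ i).ae_nonneg)
  rw [withDensity_apply _ (MeasurableSet.univ_pi hB), volume_restrict_Icc_pi,
    Measure.restrict_pi_pi, ← ofReal_integral_eq_lintegral_ofReal]
  · rw [integral_fintype_prod_eq_prod, ENNReal.ofReal_prod_of_nonneg fun i _ => hnn i]
    exact Finset.prod_congr rfl fun i _ => ((hφ i).pdfMeasure_apply (hab i) (hB i)).symm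
  · exact Integrable.fintype_prod fun i => Integrable.restrict ((hφ i).integrableOn (hab i))
  · have : ∀ i, ∀ᵐ x ∂(Measure.pi fun i => (volume.restrict (Set.Icc (a i) (b i))).restrict (B i)),
        0 ≤ φ i (x i) := fun i =>
      (Measure.tendsto_eval_ae_ae
        (μ := fun i => (volume.restrict (Set.Icc (a i) (b i))).restrict (B i)) (i := i)).eventually
        (ae_restrict_of_ae (hφ i).ae_nonneg)
    filter_upwards [ae_all_iff.mpr this] with x hx
    exact Finset.prod_nonneg fun i _ => hx i

lemma integral_pi_pdfMeasure {s : ℕ} {a b : Fin s → ℝ} (hab : ∀ i, a i ≤ b i)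
    {φ : Fin s → ℝ → ℝ} (hφ : ∀ i, IsPDFOn (φ i) (a i) (b i)) (F : (Fin s → ℝ) → ℝ) :
    ∫ x, F x ∂(Measure.pi fun i => pdfMeasure (φ i) (a i) (b i)) =
      ∫ x in Set.Icc a b, F x * ∏ i, φ i (x i) := by
  have hint : Integrable (fun x : Fin s → ℝ => ∏ i, φ i (x i)) (volume.restrict (Set.Icc a b)) := by
    rw [volume_restrict_Icc_pi]
    exact Integrable.fintype_prod fun i => (hφ i).integrableOn (hab i)
  rw [pi_pdfMeasure hab hφ, integral_withDensity_eq_integral_toReal_smul₀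
    hint.aestronglyMeasurable.aemeasurable.ennreal_ofReal (ae_of_all _ fun _ => ENNReal.ofReal_lt_top)]
  refine setIntegral_congr_fun measurableSet_Icc fun x hx => ?_
  have : 0 ≤ ∏ i, φ i (x i) := Finset.prod_nonneg fun i _ => (hφ i).1 _ ⟨hx.1 i, hx.2 i⟩
  simp only [ENNReal.toReal_ofReal this, smul_eq_mul, mul_comm]

/-! ### The inverse distribution function -/

lemma IsPDFOn.strictMonoOn_cdfFrom {ψ : ℝ → ℝ} {a b : ℝ} (h : IsPDFOn ψ a b) (hab : a ≤ b)
    (hΦ : Set.BijOn (cdfFrom ψ a) (Set.Icc a b) (Set.Icc 0 1)) :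
    StrictMonoOn (cdfFrom ψ a) (Set.Icc a b) := by
  have := h.isProbabilityMeasure hab
  refine MonotoneOn.strictMonoOn_of_injOn ?_ hΦ.injOn
  intro x hx y hy hxy
  rw [← h.pdfMeasure_real_Iic hx, ← h.pdfMeasure_real_Iic hy]
  exact measureReal_mono (Set.Iic_subset_Iic.mpr hxy)

lemma invCDF_mem {s : ℕ} {a b : Fin s → ℝ} {φ : Fin s → ℝ → ℝ}
    (hΦ : ∀ i, Set.BijOn (cdfFrom (φ i) (a i)) (Set.Icc (a i) (b i)) (Set.Icc 0 1))
    {y : Fin s → ℝ} (hy : ∀ i, y i ∈ Set.Icc (0 : ℝ) 1) (i : Fin s) :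
    invCDF a b φ y i ∈ Set.Icc (a i) (b i) :=
  Function.invFunOn_mem ((hΦ i).surjOn (hy i))

lemma invCDF_lt_iff {s : ℕ} {a b : Fin s → ℝ} (hab : ∀ i, a i ≤ b i) {φ : Fin s → ℝ → ℝ}
    (hφ : ∀ i, IsPDFOn (φ i) (a i) (b i))
    (hΦ : ∀ i, Set.BijOn (cdfFrom (φ i) (a i)) (Set.Icc (a i) (b i)) (Set.Icc 0 1))
    {y : Fin s → ℝ} (hy : ∀ i, y i ∈ Set.Icc (0 : ℝ) 1) (i : Fin s) {t : ℝ}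
    (ht : t ∈ Set.Icc (a i) (b i)) :
    invCDF a b φ y i < t ↔ y i < cdfFrom (φ i) (a i) t := by
  rw [← ((hφ i).strictMonoOn_cdfFrom (hab i) (hΦ i)).lt_iff_lt (invCDF_mem hΦ hy i) ht]
  rw [invCDF, Function.invFunOn_eq ((hΦ i).surjOn (hy i))]

/-! ### Regularity of the mixed partial derivatives -/

/-- The projection of `ℝˢ` onto the box `[a, b]`. -/
def clamp {s : ℕ} (a b : Fin s → ℝ) (x : Fin s → ℝ) : Fin s → ℝ :=
  fun i => max (a i) (min (b i) (x i))

lemma continuous_clamp {s : ℕ} (a b : Fin s → ℝ) : Continuous (clamp a b) := by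
  unfold clamp; fun_prop

lemma clamp_mem {s : ℕ} {a b : Fin s → ℝ} (hab : ∀ i, a i ≤ b i) (x : Fin s → ℝ) :
    clamp a b x ∈ Set.Icc a b :=
  ⟨fun _ => le_max_left _ _, fun i => max_le (hab i) (min_le_left _ _)⟩

lemma clamp_of_mem {s : ℕ} {a b x : Fin s → ℝ} (hx : x ∈ Set.Icc a b) : clamp a b x = x := by
  funext i
  simp [clamp, hx.1 i, hx.2 i]

lemma clamp_update {s : ℕ} (a b x : Fin s → ℝ) (i : Fin s) {t : ℝ}
    (ht : t ∈ Set.Icc (a i) (b i)) :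
    clamp a b (Function.update x i t) = Function.update (clamp a b x) i t := by
  funext j
  by_cases hj : j = i
  · subst hj; simp [clamp, ht.1, ht.2]
  · simp [clamp, hj]

lemma update_mem_Icc {s : ℕ} {a b x : Fin s → ℝ} (hx : x ∈ Set.Icc a b) {i : Fin s} {t : ℝ}
    (ht : t ∈ Set.Icc (a i) (b i)) : Function.update x i t ∈ Set.Icc a b := by
  constructor <;> intro j <;> by_cases hj : j = i
  · subst hj; simpa using ht.1
  · simpa [hj] using hx.1 j
  · subst hj; simpa using ht.2
  · simpa [hj] using hx.2 j

/-- The least index heads the sorted list, so `foldr` applies its derivative outermost. -/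
lemma mixedPartial_insert {s : ℕ} (a b : Fin s → ℝ) {u : Finset (Fin s)} {i : Fin s}
    (hi : ∀ j ∈ u, i < j) (F : (Fin s → ℝ) → ℝ) :
    mixedPartial a b (insert i u) F = partialD a b i (mixedPartial a b u F) := by
  have hiu : i ∉ u := fun h => lt_irrefl _ (hi i h)
  rw [mixedPartial, Finset.sort_insert _ (fun j hj => (hi j hj).le) hiu]
  rfl

lemma HasMixedPartials.hasDerivWithinAt {s : ℕ} {a b : Fin s → ℝ} {F : (Fin s → ℝ) → ℝ}
    (hF : HasMixedPartials a b F) {u : Finset (Fin s)} {i : Fin s} (hi : ∀ j ∈ u, i < j)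
    {x : Fin s → ℝ} (hx : x ∈ Set.Icc a b) {t : ℝ} (ht : t ∈ Set.Icc (a i) (b i)) :
    HasDerivWithinAt (fun τ => mixedPartial a b u F (Function.update x i τ))
      (mixedPartial a b (insert i u) F (Function.update x i t)) (Set.Icc (a i) (b i)) t := by
  have h := (hF u i hi _ (update_mem_Icc hx ht)).hasDerivWithinAt
  rw [mixedPartial_insert a b hi, partialD]
  simpa only [Function.update_idem, Function.update_self] using h

/-- Continuity is not assumed. Bounded first partial derivatives make F Lipschitz in each variable
by the mean value inequality, and changing coordinates one at a time gives a joint Lipschitz bound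
on the box. -/
lemma HasMixedPartials.continuous_clamp {s : ℕ} {a b : Fin s → ℝ} (hab : ∀ i, a i ≤ b i)
    {F : (Fin s → ℝ) → ℝ} (hF : HasMixedPartials a b F) {M : Finset (Fin s) → ℝ}
    (hM : ∀ u, ∀ x ∈ Set.Icc a b, |mixedPartial a b u F x| ≤ M u) :
    Continuous fun x => F (clamp a b x) := by
  have h1 : ∀ x ∈ Set.Icc a b, ∀ i, ∀ t ∈ Set.Icc (a i) (b i),
      |F (Function.update x i t) - F x| ≤ M {i} * |t - x i| := by
    intro x hx i t ht
    have h := Convex.norm_image_sub_le_of_norm_hasDerivWithin_le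
      (fun t ht => hF.hasDerivWithinAt (u := ∅) (i := i) (by simp) hx ht)
      (fun t ht => hM (insert i ∅) _ (update_mem_Icc hx ht)) (convex_Icc (a i) (b i))
      (⟨hx.1 i, hx.2 i⟩ : x i ∈ Set.Icc (a i) (b i)) ht
    simpa [mixedPartial] using h
  have h2 : ∀ x ∈ Set.Icc a b, ∀ y ∈ Set.Icc a b, ∀ S : Finset (Fin s),
      |F (S.piecewise x y) - F y| ≤ ∑ i ∈ S, M {i} * |x i - y i| := by
    intro x hx y hy S
    induction S using Finset.induction_on with
    | empty => simp
    | insert i S hi ih =>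
      rw [Finset.piecewise_insert, Finset.sum_insert hi]
      have hmem : S.piecewise x y ∈ Set.Icc a b :=
        Finset.piecewise_mem_Icc_of_mem_of_mem S hx hy
      have h3 := h1 _ hmem i (x i) ⟨hx.1 i, hx.2 i⟩
      rw [Finset.piecewise_eq_of_notMem _ _ _ hi] at h3
      calc _ = |(F (Function.update (S.piecewise x y) i (x i)) - F (S.piecewise x y)) +
            (F (S.piecewise x y) - F y)| := by congr 1; ring
        _ ≤ _ := (abs_add_le _ _).trans (add_le_add h3 ih)
  rw [continuous_iff_continuousAt]
  intro y
  rw [ContinuousAt, tendsto_iff_dist_tendsto_zero]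
  refine squeeze_zero (g := fun x => ∑ i, M {i} * |clamp a b x i - clamp a b y i|)
    (fun _ => dist_nonneg) (fun x => ?_) ?_
  · have := h2 _ (clamp_mem hab x) _ (clamp_mem hab y) Finset.univ
    rwa [Finset.piecewise_univ] at this
  · have hc := PolyLatticeQMC.continuous_clamp a b
    refine Continuous.tendsto' ?_ _ _ (by simp)
    fun_prop

/-- A measurable choice of points converging to `t` within `[a, b]`. -/
def approachPoint (a b : ℝ) (n : ℕ) (t : ℝ) : ℝ :=
  -- Moving towards an endpoint at distance at least half the length keeps the point inside [a, b]
  -- and different from t.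
  t + ((if t ≤ (a + b) / 2 then b else a) - t) * (1 / ((n : ℝ) + 1))

lemma measurable_approachPoint (a b : ℝ) (n : ℕ) : Measurable (approachPoint a b n) :=
  measurable_id.add (((Measurable.ite measurableSet_Iic measurable_const measurable_const).sub
    measurable_id).mul_const _)

lemma approachPoint_mem {a b : ℝ} (hab : a < b) (n : ℕ) {t : ℝ} (ht : t ∈ Set.Icc a b) :
    approachPoint a b n t ∈ Set.Icc a b \ {t} := by
  have h1 : (0 : ℝ) < 1 / ((n : ℝ) + 1) := by positivity
  have h2 : 1 / ((n : ℝ) + 1) ≤ 1 := by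
    rw [div_le_one (by positivity)]
    linarith [(Nat.cast_nonneg n : (0 : ℝ) ≤ n)]
  unfold approachPoint
  generalize 1 / ((n : ℝ) + 1) = r at *
  obtain ⟨h3, h4⟩ := ht
  split_ifs with h
  · have h5 : 0 < b - t := by linarith
    have h6 := mul_pos h5 h1
    have h7 := mul_le_of_le_one_right h5.le h2
    exact ⟨⟨by linarith, by linarith⟩, fun h8 => by
      rw [Set.mem_singleton_iff] at h8; linarith⟩
  · have h5 : 0 < t - a := by linarith
    have h6 := mul_pos h5 h1
    have h7 := mul_le_of_le_one_right h5.le h2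
    exact ⟨⟨by linarith, by linarith⟩, fun h8 => by
      rw [Set.mem_singleton_iff] at h8; linarith⟩

lemma tendsto_approachPoint {a b : ℝ} (hab : a < b) {t : ℝ} (ht : t ∈ Set.Icc a b) :
    Filter.Tendsto (fun n => approachPoint a b n t) Filter.atTop
      (nhdsWithin t (Set.Icc a b \ {t})) := by
  refine tendsto_nhdsWithin_iff.mpr
    ⟨?_, Filter.Eventually.of_forall fun n => approachPoint_mem hab n ht⟩
  have := (tendsto_one_div_add_atTop_nhds_zero_nat (𝕜 := ℝ)).const_mul
    ((if t ≤ (a + b) / 2 then b else a) - t)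
  simpa [approachPoint] using this.const_add t

/-- Each new derivative is a pointwise limit of difference quotients along `approachPoint`, so
measurability passes from u to `insert i u`, starting from the continuous F. -/
lemma HasMixedPartials.measurable_clamp {s : ℕ} {a b : Fin s → ℝ} (hab : ∀ i, a i < b i)
    {F : (Fin s → ℝ) → ℝ} (hF : HasMixedPartials a b F)
    (hc : Continuous fun x => F (clamp a b x)) (u : Finset (Fin s)) :
    Measurable fun x => mixedPartial a b u F (clamp a b x) := by
  induction u using Finset.induction_on_min with
  | empty => simpa [mixedPartial] using hc.measurable
  | insert i u hi ih =>
    have hle : ∀ i, a i ≤ b i := fun i => (hab i).le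
    have hcl : Measurable (clamp a b) := (PolyLatticeQMC.continuous_clamp a b).measurable
    have hcli : Measurable fun x => clamp a b x i := (measurable_pi_apply i).comp hcl
    have hq : ∀ n, Measurable fun x => approachPoint (a i) (b i) n (clamp a b x i) := fun n =>
      (measurable_approachPoint _ _ n).comp hcli
    refine measurable_of_tendsto_metrizable (f := fun n x =>
      (approachPoint (a i) (b i) n (clamp a b x i) - clamp a b x i)⁻¹ *
        (mixedPartial a b u F (clamp a b
          (Function.update x i (approachPoint (a i) (b i) n (clamp a b x i)))) -
          mixedPartial a b u F (clamp a b x))) (fun n => ?_) ?_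
    · refine ((hq n).sub hcli).inv.mul (Measurable.sub ?_ ih)
      refine ih.comp ?_
      exact measurable_update'.comp (measurable_id.prodMk (hq n))
    · rw [tendsto_pi_nhds]
      intro x
      have hx := clamp_mem hle x
      have hxi : clamp a b x i ∈ Set.Icc (a i) (b i) := ⟨hx.1 i, hx.2 i⟩
      have h := hF.hasDerivWithinAt hi hx hxi
      rw [hasDerivWithinAt_iff_tendsto_slope, Function.update_eq_self] at h
      have h' := h.comp (tendsto_approachPoint (hab i) hxi)
      refine h'.congr fun n => ?_
      rw [Function.comp_apply, slope_def_field, Function.update_eq_self,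
        clamp_update _ _ _ _ (approachPoint_mem (hab i) n hxi).1, div_eq_inv_mul]

lemma HasMixedPartials.isDerivFamily {s : ℕ} {a b : Fin s → ℝ} (hab : ∀ i, a i < b i)
    {F : (Fin s → ℝ) → ℝ} (hF : HasMixedPartials a b F) {M : Finset (Fin s) → ℝ}
    (hM : ∀ u, ∀ x ∈ Set.Icc a b, |mixedPartial a b u F x| ≤ M u) :
    IsDerivFamily a b M fun u x => mixedPartial a b u F (clamp a b x) where
  measurable := hF.measurable_clamp hab (hF.continuous_clamp (fun i => (hab i).le) hM)
  abs_le u x := hM u _ (clamp_mem (fun i => (hab i).le) x)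
  hasDeriv u i hi x t ht := by
    rw [clamp_update a b x i ht]
    refine (hF.hasDerivWithinAt hi (clamp_mem (fun i => (hab i).le) x) ht).congr
      (fun τ hτ => ?_) ?_
    · rw [clamp_update a b x i hτ]
    · rw [clamp_update a b x i ht]

lemma abs_mixedPartial_le {s : ℕ} {a b : Fin s → ℝ} {γ : Finset (Fin s) → ℝ} (hγ : ∀ u, 0 < γ u)
    {F : (Fin s → ℝ) → ℝ} (hF : weightedNorm ∞ a b γ F ≤ 1) (u : Finset (Fin s))
    (x : Fin s → ℝ) (hx : x ∈ Set.Icc a b) : |mixedPartial a b u F x| ≤ γ u := by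
  rw [weightedNorm, if_pos rfl] at hF
  have h1 : normTerm a b γ F u ≤ 1 := (le_iSup (normTerm a b γ F) u).trans hF
  have h2 : ENNReal.ofReal (1 / γ u) * ENNReal.ofReal |mixedPartial a b u F x| ≤ 1 := by
    refine le_trans (mul_le_mul_right ?_ _) h1
    exact le_iSup₂ (f := fun x (_ : x ∈ Set.Icc a b) => ENNReal.ofReal |mixedPartial a b u F x|) x hx
  have hpos := hγ u
  rw [← ENNReal.ofReal_mul (by positivity), ENNReal.ofReal_le_one, one_div,
    inv_mul_le_iff₀ hpos, mul_one] at h2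
  exact h2

/-! ### The worst-case error of polynomial lattice rules -/

lemma polyLattice_mem {s : ℕ} (g : Fin s → (ZMod 2)[X]) (f : (ZMod 2)[X]) (h : G f.natDegree)
    (i : Fin s) : polyLattice g f h i ∈ Set.Icc (0 : ℝ) 1 := by
  rw [polyLattice, ← bval_digits]
  exact ⟨bval_nonneg _, (bval_lt_one _).le⟩

lemma abs_qmcError_polyLattice_le {s : ℕ} {a b : Fin s → ℝ} (hab : ∀ i, a i < b i)
    {φ : Fin s → ℝ → ℝ} (hφ : ∀ i, IsPDFOn (φ i) (a i) (b i))
    (hΦ : ∀ i, Set.BijOn (cdfFrom (φ i) (a i)) (Set.Icc (a i) (b i)) (Set.Icc 0 1))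
    {M : Finset (Fin s) → ℝ} {F : (Fin s → ℝ) → ℝ} (hF : HasMixedPartials a b F)
    (hM : ∀ u, ∀ x ∈ Set.Icc a b, |mixedPartial a b u F x| ≤ M u)
    (g : Fin s → (ZMod 2)[X]) (f : (ZMod 2)[X]) :
    |qmcError a b φ (polyLattice g f) F| ≤ 1 / 2 ^ f.natDegree *
      ∑ u : Finset (Fin s) with u.Nonempty, M u * (u.card + ∑ h : G f.natDegree,
        ∏ i ∈ u, walMajorant (latticeDigits f (g i) f.natDegree h)) * ∏ i ∈ u, (b i - a i) := by
  have hle : ∀ i, a i ≤ b i := fun i => (hab i).le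
  have := fun i => (hφ i).isProbabilityMeasure (hle i)
  have hy := fun h => polyLattice_mem g f h
  have hmem : ∀ h, invCDF a b φ (polyLattice g f h) ∈ Set.Icc a b := fun h =>
    ⟨fun i => (invCDF_mem hΦ (hy h) i).1, fun i => (invCDF_mem hΦ (hy h) i).2⟩
  have hmain := (hF.isDerivFamily hab hM).abs_error_le hle
    (fun i => pdfMeasure (φ i) (a i) (b i)) (fun i => pdfMeasure_ae_mem _ _ _)
    (fun h => invCDF a b φ (polyLattice g f h)) hmem
    (fun u => u.card + ∑ h : G f.natDegree,
      ∏ i ∈ u, walMajorant (latticeDigits f (g i) f.natDegree h)) ?_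
  · rw [integral_pi_pdfMeasure hle hφ, card_G] at hmain
    have hE : qmcError a b φ (polyLattice g f) F = 1 / ((2 ^ f.natDegree : ℕ) : ℝ) *
        ∑ h, mixedPartial a b ∅ F (clamp a b (invCDF a b φ (polyLattice g f h))) -
          ∫ x in Set.Icc a b, mixedPartial a b ∅ F (clamp a b x) * ∏ i, φ i (x i) := by
      rw [qmcError, card_G]
      congr 1
      · congr 1
        exact Finset.sum_congr rfl fun h _ => by rw [clamp_of_mem (hmem h)]; simp [mixedPartial]
      · refine setIntegral_congr_fun measurableSet_Icc fun x hx => ?_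
        simp only [clamp_of_mem hx]
        simp [mixedPartial]
    rw [hE]
    push_cast at hmain ⊢
    exact hmain
  · intro u t ht
    have hti : ∀ i, t i ∈ Set.Icc (a i) (b i) := fun i => ⟨ht.1 i, ht.2 i⟩
    have h1 := abs_sum_prod_discrepancy_le g f u (fun i => cdfFrom (φ i) (a i) (t i))
      fun i => (hΦ i).mapsTo (hti i)
    -- Since Φ⁻¹(y) < t is equivalent to y < Φ(t), the kernel at the transformed nodes is the local
    -- discrepancy of the lattice points at z = Φ(t).
    refine le_of_eq_of_le ?_ h1
    congr 1
    refine Finset.sum_congr rfl fun h _ => Finset.prod_congr rfl fun i _ => ?_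
    rw [discKernel, (hφ i).pdfMeasure_real_Iic (hti i),
      if_congr (invCDF_lt_iff hle hφ hΦ (hy h) i (hti i)) rfl rfl]

/-- The weighted sum over all u is averaged at once, so that one vector serves every u together; the
right side is the exact mean. -/
lemma exists_generator_sum_le {s : ℕ} {f : (ZMod 2)[X]} (hf : Irreducible f)
    (w : Finset (Fin s) → ℝ) :
    ∃ g : Fin s → G f.natDegree, ∑ u : Finset (Fin s) with u.Nonempty,
        w u * ∑ h : G f.natDegree, ∏ i ∈ u, walMajorant (latticeDigits f (g i) f.natDegree h) ≤
      ∑ u : Finset (Fin s) with u.Nonempty, w u * ((f.natDegree : ℝ) / 2) ^ u.card := by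
  refine (Finset.exists_le_of_sum_le (s := Finset.univ)
    (f := fun g : Fin s → G f.natDegree => ∑ u : Finset (Fin s) with u.Nonempty,
        w u * ∑ h : G f.natDegree, ∏ i ∈ u, walMajorant (latticeDigits f (g i) f.natDegree h))
    (g := fun _ => ∑ u : Finset (Fin s) with u.Nonempty, w u * ((f.natDegree : ℝ) / 2) ^ u.card)
    Finset.univ_nonempty ?_).imp fun _ h => h.2
  rw [Finset.sum_comm, Finset.sum_const, Finset.card_univ, Fintype.card_fun, card_G,
    Fintype.card_fin, Finset.smul_sum]
  refine Finset.sum_le_sum fun u hu => le_of_eq ?_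
  rw [← Finset.mul_sum, sum_sum_prod_walMajorant hf u (Finset.mem_filter.mp hu).2, nsmul_eq_mul]
  push_cast
  ring

end

end PolyLatticeQMC

theorem mainTheorem7 (s : ℕ) (a b : Fin s → ℝ) (hab : ∀ i, a i < b i)
    (φ : Fin s → ℝ → ℝ) (hφ : ∀ i, PolyLatticeQMC.IsPDFOn (φ i) (a i) (b i))
    (hΦ : ∀ i, Set.BijOn (PolyLatticeQMC.cdfFrom (φ i) (a i))
      (Set.Icc (a i) (b i)) (Set.Icc 0 1))
    (γ : Finset (Fin s) → ℝ) (hγ : ∀ u, 0 < γ u)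
    (m : ℕ) (f : (ZMod 2)[X]) (hf : Irreducible f) (hm : f.natDegree = m) :
    ∃ g : Fin s → (ZMod 2)[X], (∀ i, g i ∈ PolyLatticeQMC.G m) ∧
      PolyLatticeQMC.worstCaseError ∞ a b γ φ (PolyLatticeQMC.polyLattice g f) ≤
        ENNReal.ofReal (1 / 2 ^ m * ∑ u : Finset (Fin s) with u.Nonempty,
          γ u * (2 ^ u.card + ((m : ℝ) / 2) ^ u.card) * ∏ i ∈ u, (b i - a i)) := by
  subst hm
  obtain ⟨g, hg⟩ := PolyLatticeQMC.exists_generator_sum_le hf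
    (fun u : Finset (Fin s) => γ u * ∏ i ∈ u, (b i - a i))
  refine ⟨fun i => g i, fun i => (g i).2, ?_⟩
  refine iSup_le fun F => iSup_le fun hF => iSup_le fun hn => ENNReal.ofReal_le_ofReal ?_
  refine (PolyLatticeQMC.abs_qmcError_polyLattice_le hab hφ hΦ hF
    (PolyLatticeQMC.abs_mixedPartial_le hγ hn) _ f).trans ?_
  refine mul_le_mul_of_nonneg_left ?_ (by positivity)
  have hsplit : ∀ A B : Finset (Fin s) → ℝ, ∑ u : Finset (Fin s) with u.Nonempty,
      γ u * (A u + B u) * ∏ i ∈ u, (b i - a i) =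
        ∑ u : Finset (Fin s) with u.Nonempty, γ u * A u * ∏ i ∈ u, (b i - a i) +
          ∑ u : Finset (Fin s) with u.Nonempty, (γ u * ∏ i ∈ u, (b i - a i)) * B u := by
    intro A B
    rw [← Finset.sum_add_distrib]
    exact Finset.sum_congr rfl fun u _ => by ring
  rw [hsplit, hsplit]
  refine add_le_add (Finset.sum_le_sum fun u _ => ?_) hg
  refine mul_le_mul_of_nonneg_right (mul_le_mul_of_nonneg_left ?_ (hγ u).le)
    (Finset.prod_nonneg fun i _ => sub_nonneg.mpr (hab i).le)
  -- The rounding cost |u| is absorbed into 2^|u|.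
  exact_mod_cast Nat.lt_two_pow_self.le
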